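/- Let $|\mathbb{S}^4|=\frac{8\pi^2}{3}$ be the volume of the standard unit sphere $\mathbb{S}^4\subset\mathbb{R}^5$, let $Q$ be a real polynomial on $\mathbb{R}^4$, and let $u:\mathbb{R}^4\to\mathbb{R}$ be a smooth function. Suppose that $u$ is a normal solution of $(-\Delta)^2u=Qe^{4u}$ on $\mathbb{R}^4$, that is: $u$ satisfies this equation, $Qe^{4u}\in L^1(\mathbb{R}^4)$, and there is a constant $C\in\mathbb{R}$ such that $$u(x)=\frac{2}{6\,|\mathbb{S}^4|}\int_{\mathbb{R}^4}\log\frac{|y|}{|x-y|}\,Q(y)e^{4u(y)}\,\mathrm{d}y+C\qquad\text{for all }x\in\mathbb{R}^4.$$ If $Q(x)\le 6$ for all $x\in\mathbb{R}^4$, then $$\int_{\mathbb{R}^4}e^{4u}\,\mathrm{d}x\ \ge\ |\mathbb{S}^4|$$ (the integral may be $+\infty$), with equality if and only if $Q\equiv 6$. -/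

import Mathlib

open MeasureTheory

/-- Euclidean four-space, with the Euclidean norm and Lebesgue measure. -/
abbrev E4 : Type := EuclideanSpace ℝ (Fin 4)

/-- The volume `|𝕊⁴|` of the standard four-sphere: the total mass of the surface measure on the
unit sphere of `ℝ⁵`. -/
noncomputable def volS4 : ENNReal :=
  (volume : Measure (EuclideanSpace ℝ (Fin 5))).toSphere Set.univ

/-- `u` is a smooth normal solution on `ℝ⁴` of `(-Δ)² u = Q e^{4u}`. Since the integrand
`Q e^{4u}` is integrable and locally bounded, and `log (|y| / |x - y|)` tends to `0` as
`|y| → ∞` and has only logarithmic singularities, the integral in the last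
clause converges absolutely for every `x`. -/
structure IsNormalSolution (Q u : E4 → ℝ) : Prop where
  smooth : ContDiff ℝ (⊤ : ℕ∞) u
  /-- `Q e^{4u}` lies in `L¹`. -/
  integrable : Integrable (fun y : E4 => Q y * Real.exp (4 * u y))
  /-- The differential equation; in it `(-Δ)² = Δ Δ`. -/
  equation : ∀ x : E4,
    Laplacian.laplacian (Laplacian.laplacian u) x = Q x * Real.exp (4 * u x)
  /-- The integral equation, with `6 = (4 - 1)!`. -/
  integral_equation : ∃ C : ℝ, ∀ x : E4,
    u x = 2 / (6 * volS4.toReal) *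
      (∫ y : E4, Real.log (‖y‖ / ‖x - y‖) * (Q y * Real.exp (4 * u y))) + C

open Set Filter Topology Metric Module

open scoped RealInnerProductSpace

/-!
Put `v = 4u`, `a = 8 / (6 |𝕊⁴|)`, `ρ = Q e^v` and `α = a ∫ ρ`, so that `v` is `a` times the
logarithmic potential of `ρ`, up to a constant; let `d` be the dimension, `b` the upper bound of `Q`
and `V = ∫ e^v`. The claim is `2 d ≤ a b V`, and only finite `V` matters. Note that `α ≤ a b V`,
strictly unless `Q ≡ b`.

The averages of `v` over the dilates `R K` of a compact set `K` behave like `-α log R`, so by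
Jensen's inequality the integrability of `Q e^v` forces `α ≥ d + deg Q`. This settles
`deg Q ≥ d`. Since `Q` is bounded above, its degree is even, so for `d ≤ 4` the remaining cases are
`deg Q = 0` and `deg Q = 2`.

The Pohozaev identity around `x₀`, obtained by testing with the field `x - x₀`, reads
`d ∫ ρ + ∫ (∇Q · (x - x₀)) e^v = (a / 2) (∫ ρ)²`. For constant `Q` it gives `α = 2 d`. A quadratic
`Q` bounded above has a maximum `x₀` with `∇Q · (x - x₀) = 2 (Q - Q(x₀))`, so the identity becomes
`4 a Q(x₀) V = 2 (d + 2) α - α²`. As `α < a Q(x₀) V`, this yields `α < 2 d`. Since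
`2 = deg Q < d`, also `α ≥ d + 2 > 4`, so `4 (a Q(x₀) V - 2 d) = (α - 4) (2 d - α) > 0`.
-/

section SingularKernels

theorem inv_norm_le_one_add_indicator {E : Type*} [SeminormedAddCommGroup E] (z : E) :
    ‖z‖⁻¹ ≤ 1 + (ball (0 : E) 1).indicator (fun z => ‖z‖⁻¹) z := by
  by_cases hz : z ∈ ball (0 : E) 1
  · simp only [indicator_of_mem hz, le_add_iff_nonneg_left, zero_le_one]
  · rw [indicator_of_notMem hz, add_zero]
    exact inv_le_one_of_one_le₀ (by simpa using hz)

theorem abs_log_div_norm_sub_le {E : Type*} [NormedAddCommGroup E] (x y : E) :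
    |Real.log (‖y‖ / ‖x - y‖)| ≤ ‖x‖ * (‖x - y‖⁻¹ + ‖y‖⁻¹) := by
  rcases eq_or_ne y 0 with rfl | hy
  · simp only [norm_zero, zero_div, Real.log_zero, abs_zero]; positivity
  rcases eq_or_ne x y with rfl | hxy
  · simp only [sub_self, norm_zero, div_zero, Real.log_zero, abs_zero]; positivity
  have hy' : 0 < ‖y‖ := norm_pos_iff.2 hy
  have hxy' : 0 < ‖x - y‖ := norm_pos_iff.2 (sub_ne_zero.2 hxy)
  have upper : Real.log (‖y‖ / ‖x - y‖) ≤ ‖x‖ * ‖x - y‖⁻¹ := by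
    refine (Real.log_le_sub_one_of_pos (div_pos hy' hxy')).trans ?_
    rw [← div_eq_mul_inv, sub_le_iff_le_add, div_add_one hxy'.ne']
    gcongr
    simpa using norm_sub_le x (x - y)
  have lower : Real.log (‖x - y‖ / ‖y‖) ≤ ‖x‖ * ‖y‖⁻¹ := by
    refine (Real.log_le_sub_one_of_pos (div_pos hxy' hy')).trans ?_
    rw [← div_eq_mul_inv, sub_le_iff_le_add, div_add_one hy'.ne']
    gcongr
    exact norm_sub_le x y
  rw [← inv_div, Real.log_inv] at lower
  have : 0 ≤ ‖x‖ * ‖x - y‖⁻¹ := by positivity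
  have : 0 ≤ ‖x‖ * ‖y‖⁻¹ := by positivity
  rw [abs_le, mul_add]
  constructor <;> linarith

variable {E : Type*} [NormedAddCommGroup E] [NormedSpace ℝ E] [FiniteDimensional ℝ E]
  [MeasurableSpace E] [BorelSpace E] {μ : Measure E} [μ.IsAddHaarMeasure]

theorem integrable_indicator_inv_norm (hE : 1 < finrank ℝ E) :
    Integrable ((ball (0 : E) 1).indicator fun z => ‖z‖⁻¹) μ := by
  rw [integrable_indicator_iff measurableSet_ball]
  refine integrableOn_ball_of_norm_le_rpow (C := 1) (α := 1) hE.le (by exact_mod_cast hE)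
    (Eventually.of_forall fun x => ?_) (by fun_prop)
  rw [Real.rpow_neg_one, norm_inv, norm_norm, one_mul]

theorem integrableOn_inv_norm_sub (hE : 1 < finrank ℝ E) {s : Set E} (hs : μ s ≠ ⊤) (y : E) :
    IntegrableOn (fun x => ‖x - y‖⁻¹) s μ := by
  have hone : IntegrableOn (fun _ : E => (1 : ℝ)) s μ := integrableOn_const hs
  refine (hone.add ((integrable_indicator_inv_norm hE).comp_sub_right y).integrableOn).mono'
    (by fun_prop) (Eventually.of_forall fun x => ?_)
  simpa using inv_norm_le_one_add_indicator (x - y)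

theorem exists_setIntegral_inv_norm_sub_le (hE : 1 < finrank ℝ E) {s : Set E} (hs : μ s ≠ ⊤) :
    ∃ M, ∀ y, ∫ x in s, ‖x - y‖⁻¹ ∂μ ≤ M := by
  set g : E → ℝ := (ball (0 : E) 1).indicator fun z => ‖z‖⁻¹
  have hg : Integrable g μ := integrable_indicator_inv_norm hE
  refine ⟨μ.real s + ∫ z, g z ∂μ, fun y => ?_⟩
  have hone : IntegrableOn (fun _ : E => (1 : ℝ)) s μ := integrableOn_const hs
  have hgy : Integrable (fun x => g (x - y)) μ := hg.comp_sub_right y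
  calc ∫ x in s, ‖x - y‖⁻¹ ∂μ
      ≤ ∫ x in s, (1 + g (x - y)) ∂μ :=
        integral_mono (integrableOn_inv_norm_sub hE hs y) (hone.add hgy.integrableOn)
          fun x => inv_norm_le_one_add_indicator (x - y)
    _ = μ.real s + ∫ x in s, g (x - y) ∂μ := by
        rw [integral_add hone hgy.integrableOn, setIntegral_const, smul_eq_mul, mul_one]
    _ ≤ μ.real s + ∫ x, g (x - y) ∂μ := by
        gcongr
        · exact Eventually.of_forall fun x => indicator_nonneg (fun z _ => by positivity) _
        · exact Measure.restrict_le_self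
    _ = μ.real s + ∫ z, g z ∂μ := by rw [integral_sub_right_eq_self]

theorem integrable_inv_norm_mul (hE : 1 < finrank ℝ E) {ρ : E → ℝ} (hc : Continuous ρ)
    (hi : Integrable ρ μ) : Integrable (fun y => ‖y‖⁻¹ * ρ y) μ := by
  rw [← integrableOn_univ, ← union_compl_self (closedBall (0 : E) 1)]
  refine IntegrableOn.union ?_ (Integrable.mono hi.integrableOn (by fun_prop) ?_)
  · have hs : μ (closedBall (0 : E) 1) ≠ ⊤ := measure_closedBall_lt_top.ne
    simpa only [sub_zero] using (integrableOn_inv_norm_sub hE hs 0).mul_continuousOn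
      hc.continuousOn (isCompact_closedBall _ _)
  · filter_upwards [ae_restrict_mem measurableSet_closedBall.compl] with y hy
    rw [norm_mul, norm_inv, norm_norm]
    have hy : 1 < ‖y‖ := by simpa using hy
    exact mul_le_of_le_one_left (norm_nonneg _) (inv_le_one_of_one_le₀ hy.le)

theorem integrable_inv_norm_sub_mul_prod (hE : 1 < finrank ℝ E) {s : Set E} (hs : μ s ≠ ⊤)
    {ρ : E → ℝ} (hi : Integrable ρ μ) :
    Integrable (fun p : E × E => ‖p.1 - p.2‖⁻¹ * ρ p.2) ((μ.restrict s).prod μ) := by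
  have hmeas : AEStronglyMeasurable (fun p : E × E => ‖p.1 - p.2‖⁻¹ * ρ p.2)
      ((μ.restrict s).prod μ) :=
    (by fun_prop : Measurable fun p : E × E => ‖p.1 - p.2‖⁻¹).aestronglyMeasurable.mul
      hi.aestronglyMeasurable.comp_snd
  obtain ⟨M, hM⟩ := exists_setIntegral_inv_norm_sub_le hE hs
  refine (integrable_prod_iff' hmeas).2 ⟨Eventually.of_forall fun y =>
    (integrableOn_inv_norm_sub hE hs y).mul_const (ρ y), ?_⟩
  refine (hi.norm.const_mul M).mono' hmeas.norm.prod_swap.integral_prod_right'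
    (Eventually.of_forall fun y => ?_)
  simp only [norm_mul, norm_inv, norm_norm, integral_mul_const]
  rw [Real.norm_of_nonneg (by positivity)]
  gcongr
  exact hM y

theorem integrable_log_mul_prod (hE : 1 < finrank ℝ E) {K : Set E} (hK : IsCompact K)
    {ρ : E → ℝ} (hc : Continuous ρ) (hi : Integrable ρ μ) :
    Integrable (fun p : E × E => Real.log (‖p.2‖ / ‖p.1 - p.2‖) * ρ p.2)
      ((μ.restrict K).prod μ) := by
  have hKμ : μ K ≠ ⊤ := hK.measure_lt_top.ne
  have : IsFiniteMeasure (μ.restrict K) := ⟨by simpa using hK.measure_lt_top⟩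
  obtain ⟨C, hC⟩ := hK.isBounded.exists_norm_le
  have hdom : Integrable (fun p : E × E => C * (‖‖p.1 - p.2‖⁻¹ * ρ p.2‖ + ‖‖p.2‖⁻¹ * ρ p.2‖))
      ((μ.restrict K).prod μ) :=
    ((integrable_inv_norm_sub_mul_prod hE hKμ hi).norm.add
      ((integrable_inv_norm_mul hE hc hi).norm.comp_snd _)).const_mul C
  have hmeas : Measurable fun p : E × E => Real.log (‖p.2‖ / ‖p.1 - p.2‖) * ρ p.2 :=
    (Measurable.log (by fun_prop)).mul (hc.measurable.comp measurable_snd)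
  refine hdom.mono' hmeas.aestronglyMeasurable ?_
  have hfst : ∀ᵐ p ∂(μ.restrict K).prod μ, p.1 ∈ K :=
    Measure.quasiMeasurePreserving_fst.ae (ae_restrict_mem hK.measurableSet)
  filter_upwards [hfst] with p hp
  calc ‖Real.log (‖p.2‖ / ‖p.1 - p.2‖) * ρ p.2‖
      ≤ ‖p.1‖ * (‖p.1 - p.2‖⁻¹ + ‖p.2‖⁻¹) * ‖ρ p.2‖ := by
        rw [norm_mul]; gcongr; exact abs_log_div_norm_sub_le p.1 p.2
    _ ≤ C * (‖p.1 - p.2‖⁻¹ + ‖p.2‖⁻¹) * ‖ρ p.2‖ := by gcongr; exact hC _ hp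
    _ = C * (‖‖p.1 - p.2‖⁻¹ * ρ p.2‖ + ‖‖p.2‖⁻¹ * ρ p.2‖) := by
        simp only [norm_mul, norm_inv, norm_norm]; ring

end SingularKernels

section Cutoff

variable {X Y : Type*} [TopologicalSpace X] [MeasurableSpace X] [OpensMeasurableSpace X]
  [MeasurableSpace Y] {μ : Measure X} {ν : Measure Y} [SFinite μ] [SFinite ν]

theorem integrable_fst_mul_of_hasCompactSupport {h : X → ℝ} (hc : Continuous h)
    (hs : HasCompactSupport h) {F : X × Y → ℝ}
    (hF : Integrable F ((μ.restrict (tsupport h)).prod ν)) :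
    Integrable (fun p => h p.1 * F p) (μ.prod ν) := by
  obtain ⟨C, hC⟩ := hc.bounded_above_of_compact_support hs
  have hprod : (μ.restrict (tsupport h)).prod ν = (μ.prod ν).restrict (tsupport h ×ˢ univ) := by
    rw [← Measure.prod_restrict, Measure.restrict_univ]
  rw [hprod] at hF
  have hsupp : (fun p : X × Y => h p.1 * F p).support ⊆ tsupport h ×ˢ univ := fun p hp =>
    ⟨subset_tsupport h (left_ne_zero_of_mul hp), mem_univ _⟩
  rw [← integrableOn_iff_integrable_of_support_subset hsupp]
  exact Integrable.bdd_mul hF (hc.measurable.comp measurable_fst).aestronglyMeasurable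
    (Eventually.of_forall fun p => hC p.1)

end Cutoff

section Divergence

variable {E : Type*} [NormedAddCommGroup E]

/-- The divergence of a vector field, as the trace of its derivative. -/
noncomputable def divergence [NormedSpace ℝ E] (ξ : E → E) (x : E) : ℝ :=
  LinearMap.trace ℝ E (fderiv ℝ ξ x)

section NormedSpace

variable [NormedSpace ℝ E]

theorem hasCompactSupport_divergence {ξ : E → E} (hs : HasCompactSupport ξ) :
    HasCompactSupport (divergence ξ) :=
  (hs.fderiv ℝ).comp_left (g := fun L : E →L[ℝ] E => LinearMap.trace ℝ E L) (by simp)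

variable [FiniteDimensional ℝ E]

theorem continuous_divergence {ξ : E → E} (hξ : ContDiff ℝ 1 ξ) : Continuous (divergence ξ) :=
  (LinearMap.continuous_of_finiteDimensional
    ((LinearMap.trace ℝ E).comp (ContinuousLinearMap.coeLM ℝ))).comp
    (hξ.continuous_fderiv one_ne_zero)

theorem divergence_smul {f : E → ℝ} {ξ : E → E} {x : E} (hf : DifferentiableAt ℝ f x)
    (hξ : DifferentiableAt ℝ ξ x) :
    divergence (fun y => f y • ξ y) x = f x * divergence ξ x + fderiv ℝ f x (ξ x) := by
  rw [divergence, fderiv_fun_smul hf hξ]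
  simp [divergence, LinearMap.trace_smulRight]

theorem divergence_sub_const (x₀ x : E) :
    divergence (fun y => y - x₀) x = finrank ℝ E := by
  simp [divergence, fderiv_sub_const]

end NormedSpace

variable [InnerProductSpace ℝ E]

theorem divergence_eq_sum_fderiv_inner {ι : Type*} [Fintype ι] (b : OrthonormalBasis ι ℝ E)
    {ξ : E → E} {x : E} (hξ : DifferentiableAt ℝ ξ x) :
    divergence ξ x = ∑ i, fderiv ℝ (fun y => ⟪b i, ξ y⟫) x (b i) := by
  rw [divergence, LinearMap.trace_eq_sum_inner _ b]
  refine Finset.sum_congr rfl fun i _ => ?_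
  simp [fderiv_inner_apply, hξ]

variable [FiniteDimensional ℝ E]

theorem abs_divergence_le {L : NNReal} {ξ : E → E} (hξ : LipschitzWith L ξ) (x : E) :
    |divergence ξ x| ≤ finrank ℝ E * L := by
  set b := stdOrthonormalBasis ℝ E
  rw [divergence, LinearMap.trace_eq_sum_inner _ b]
  refine (Finset.abs_sum_le_sum_abs _ _).trans ?_
  refine (Finset.sum_le_sum (g := fun _ => (L : ℝ)) fun i _ => ?_).trans (by simp)
  calc |⟪b i, fderiv ℝ ξ x (b i)⟫| ≤ ‖b i‖ * (‖fderiv ℝ ξ x‖ * ‖b i‖) :=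
        (abs_real_inner_le_norm _ _).trans (by gcongr; exact (fderiv ℝ ξ x).le_opNorm _)
    _ ≤ L := by simpa using norm_fderiv_le_of_lipschitz ℝ hξ

variable [MeasurableSpace E] [BorelSpace E] {μ : Measure E} [μ.IsAddHaarMeasure]

theorem integral_mul_fderiv_of_hasCompactSupport {f g : E → ℝ} (hf : ContDiff ℝ 1 f)
    (hg : ContDiff ℝ 1 g) (hs : HasCompactSupport g) (v : E) :
    ∫ x, f x * fderiv ℝ g x v ∂μ = -∫ x, fderiv ℝ f x v * g x ∂μ := by
  have hf' : Continuous fun x => fderiv ℝ f x v :=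
    (hf.continuous_fderiv one_ne_zero).clm_apply continuous_const
  have hg' : Continuous fun x => fderiv ℝ g x v :=
    (hg.continuous_fderiv one_ne_zero).clm_apply continuous_const
  exact integral_mul_fderiv_eq_neg_fderiv_mul_of_integrable
    ((hf'.mul hg.continuous).integrable_of_hasCompactSupport hs.mul_left)
    ((hf.continuous.mul hg').integrable_of_hasCompactSupport (hs.fderiv_apply ℝ v).mul_left)
    ((hf.continuous.mul hg.continuous).integrable_of_hasCompactSupport hs.mul_left)
    (fun x _ => hf.differentiable one_ne_zero x) (fun x _ => hg.differentiable one_ne_zero x)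

theorem integral_mul_divergence {f : E → ℝ} {ξ : E → E} (hf : ContDiff ℝ 1 f)
    (hξ : ContDiff ℝ 1 ξ) (hs : HasCompactSupport ξ) :
    ∫ x, f x * divergence ξ x ∂μ = -∫ x, fderiv ℝ f x (ξ x) ∂μ := by
  set b := stdOrthonormalBasis ℝ E
  have hξi (i) : ContDiff ℝ 1 fun x => ⟪b i, ξ x⟫ := contDiff_const.inner ℝ hξ
  have hsi (i) : HasCompactSupport fun x => ⟪b i, ξ x⟫ :=
    hs.comp_left (g := fun v => ⟪b i, v⟫) (inner_zero_right _)
  have hexpand (x : E) : fderiv ℝ f x (ξ x) = ∑ i, fderiv ℝ f x (b i) * ⟪b i, ξ x⟫ := by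
    conv_lhs => rw [← b.sum_repr' (ξ x)]
    simp [mul_comm]
  simp_rw [hexpand, divergence_eq_sum_fderiv_inner b (hξ.differentiable one_ne_zero _),
    Finset.mul_sum]
  rw [integral_finsetSum, integral_finsetSum, ← Finset.sum_neg_distrib]
  · exact Finset.sum_congr rfl fun i _ =>
      integral_mul_fderiv_of_hasCompactSupport hf (hξi i) (hsi i) (b i)
  · exact fun i _ => (((hf.continuous_fderiv one_ne_zero).clm_apply continuous_const).mul
      (hξi i).continuous).integrable_of_hasCompactSupport (hsi i).mul_left
  · exact fun i _ => (hf.continuous.mul (((hξi i).continuous_fderiv one_ne_zero).clm_apply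
      continuous_const)).integrable_of_hasCompactSupport ((hsi i).fderiv_apply ℝ (b i)).mul_left

theorem integral_divergence_eq_zero {ζ : E → E} (hζ : ContDiff ℝ 1 ζ)
    (hs : HasCompactSupport ζ) : ∫ x, divergence ζ x ∂μ = 0 := by
  simpa using integral_mul_divergence (μ := μ) (contDiff_const (c := (1 : ℝ))) hζ hs

end Divergence

section LogarithmicSingularity

theorem abs_half_log_sq_add_le {t ε : ℝ} (ht : 0 < t) (hε : 0 < ε) (hε1 : ε ≤ 1) :
    |2⁻¹ * Real.log (t ^ 2 + ε)| ≤ t⁻¹ + t ^ 2 := by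
  have upper := Real.log_le_sub_one_of_pos (show 0 < t ^ 2 + ε by positivity)
  have lower : 2 * Real.log t ≤ Real.log (t ^ 2 + ε) := by
    rw [← Nat.cast_two, ← Real.log_pow]
    exact Real.log_le_log (by positivity) (by linarith)
  have := Real.one_sub_inv_le_log_of_pos ht
  have := inv_pos.2 ht
  rw [abs_le]
  constructor <;> nlinarith

variable {E : Type*} [NormedAddCommGroup E] [InnerProductSpace ℝ E]

theorem contDiff_half_log_norm_sq_add {ε : ℝ} (hε : 0 < ε) :
    ContDiff ℝ 1 fun x : E => 2⁻¹ * Real.log (‖x‖ ^ 2 + ε) :=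
  contDiff_const.mul (((contDiff_id.norm_sq ℝ).add contDiff_const).log fun _ => by positivity)

theorem fderiv_half_log_norm_sq_add {ε : ℝ} (hε : 0 < ε) (x v : E) :
    fderiv ℝ (fun x : E => 2⁻¹ * Real.log (‖x‖ ^ 2 + ε)) x v = ⟪x, v⟫ / (‖x‖ ^ 2 + ε) := by
  have h := (((hasFDerivAt_id x).norm_sq.add_const ε).log (by positivity)).const_mul (2⁻¹ : ℝ)
  rw [HasFDerivAt.fderiv (by exact h)]
  simp only [id_eq, ContinuousLinearMap.comp_id, smul_apply, coe_innerSL_apply, nsmul_eq_mul,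
    Nat.cast_ofNat, smul_eq_mul]
  ring

variable [FiniteDimensional ℝ E] [MeasurableSpace E] [BorelSpace E] {μ : Measure E}
  [μ.IsAddHaarMeasure]

theorem ae_norm_pos (hE : 0 < finrank ℝ E) : ∀ᵐ x ∂μ, 0 < ‖x‖ := by
  have : Nontrivial E := nontrivial_of_finrank_pos hE
  filter_upwards [μ.ae_ne 0] with x hx using norm_pos_iff.2 hx

theorem integrable_log_norm_mul (hE : 1 < finrank ℝ E) {h : E → ℝ} (hc : Continuous h)
    (hs : HasCompactSupport h) : Integrable (fun x => Real.log ‖x‖ * h x) μ := by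
  have hinv : Integrable (fun x => ‖x‖⁻¹ * |h x|) μ :=
    integrable_inv_norm_mul hE hc.abs (hc.abs.integrable_of_hasCompactSupport hs.abs)
  have hnorm : Integrable (fun x => ‖x‖ * |h x|) μ :=
    (continuous_norm.mul hc.abs).integrable_of_hasCompactSupport hs.abs.mul_left
  refine (hinv.add hnorm).mono' (AEStronglyMeasurable.mul
    (Measurable.aestronglyMeasurable (by fun_prop)) hc.aestronglyMeasurable)
    (Eventually.of_forall fun x => ?_)
  have hlog : |Real.log ‖x‖| ≤ ‖x‖⁻¹ + ‖x‖ := by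
    have := Real.neg_inv_le_log (norm_nonneg x)
    have := Real.log_le_self (norm_nonneg x)
    have := norm_nonneg x
    have := inv_nonneg.2 (norm_nonneg x)
    rw [abs_le]
    constructor <;> linarith
  simpa only [norm_mul, Real.norm_eq_abs, Pi.add_apply, ← add_mul] using
    mul_le_mul_of_nonneg_right hlog (abs_nonneg (h x))

theorem tendsto_integral_half_log_mul (hE : 1 < finrank ℝ E) {h : E → ℝ} (hc : Continuous h)
    (hs : HasCompactSupport h) :
    Tendsto (fun ε => ∫ x, 2⁻¹ * Real.log (‖x‖ ^ 2 + ε) * h x ∂μ) (𝓝[>] 0)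
      (𝓝 (∫ x, Real.log ‖x‖ * h x ∂μ)) := by
  have hε : ∀ᶠ ε : ℝ in 𝓝[>] 0, 0 < ε ∧ ε ≤ 1 := Ioc_mem_nhdsGT one_pos
  refine tendsto_integral_filter_of_dominated_convergence
    (fun x => ‖x‖⁻¹ * |h x| + ‖x‖ ^ 2 * |h x|) ?_ ?_ ?_ ?_
  · filter_upwards with ε
    exact AEStronglyMeasurable.mul (Measurable.aestronglyMeasurable (by fun_prop))
      hc.aestronglyMeasurable
  · filter_upwards [hε] with ε hε
    filter_upwards [ae_norm_pos (by omega)] with x hx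
    rw [norm_mul, Real.norm_eq_abs, Real.norm_eq_abs, ← add_mul]
    gcongr
    exact abs_half_log_sq_add_le hx hε.1 hε.2
  · exact (integrable_inv_norm_mul hE hc.abs (hc.abs.integrable_of_hasCompactSupport hs.abs)).add
      (Continuous.integrable_of_hasCompactSupport (by fun_prop) hs.abs.mul_left)
  · filter_upwards [ae_norm_pos (by omega)] with x hx
    have hlim : Tendsto (fun ε => 2⁻¹ * Real.log (‖x‖ ^ 2 + ε)) (𝓝 0)
        (𝓝 (2⁻¹ * Real.log (‖x‖ ^ 2 + 0))) :=
      ((tendsto_id.const_add _).log (by positivity)).const_mul _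
    rw [add_zero, Real.log_pow, Nat.cast_two, inv_mul_cancel_left₀ two_ne_zero] at hlim
    exact (hlim.mono_left nhdsWithin_le_nhds).mul_const _

theorem tendsto_integral_inner_div_norm_sq_add (hE : 1 < finrank ℝ E) {ζ : E → E}
    (hc : Continuous ζ) (hs : HasCompactSupport ζ) :
    Tendsto (fun ε => ∫ x, ⟪x, ζ x⟫ / (‖x‖ ^ 2 + ε) ∂μ) (𝓝[>] 0)
      (𝓝 (∫ x, ⟪x, ζ x⟫ / ‖x‖ ^ 2 ∂μ)) := by
  have hε : ∀ᶠ ε : ℝ in 𝓝[>] 0, 0 < ε := self_mem_nhdsWithin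
  refine tendsto_integral_filter_of_dominated_convergence (fun x => ‖x‖⁻¹ * ‖ζ x‖) ?_ ?_ ?_ ?_
  · filter_upwards with ε
    exact Measurable.aestronglyMeasurable (by fun_prop)
  · filter_upwards [hε] with ε hε
    filter_upwards [ae_norm_pos (by omega)] with x hx
    rw [Real.norm_eq_abs, abs_div, abs_of_pos (show 0 < ‖x‖ ^ 2 + ε by positivity)]
    calc |⟪x, ζ x⟫| / (‖x‖ ^ 2 + ε) ≤ ‖x‖ * ‖ζ x‖ / ‖x‖ ^ 2 := by
          gcongr
          · exact abs_real_inner_le_norm _ _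
          · linarith
      _ = ‖x‖⁻¹ * ‖ζ x‖ := by field_simp
  · exact integrable_inv_norm_mul hE hc.norm (hc.norm.integrable_of_hasCompactSupport hs.norm)
  · filter_upwards [ae_norm_pos (by omega)] with x hx
    have hlim : Tendsto (fun ε => ⟪x, ζ x⟫ / (‖x‖ ^ 2 + ε)) (𝓝 0)
        (𝓝 (⟪x, ζ x⟫ / (‖x‖ ^ 2 + 0))) :=
      tendsto_const_nhds.div (tendsto_id.const_add _) (by positivity)
    rw [add_zero] at hlim
    exact hlim.mono_left nhdsWithin_le_nhds

theorem integral_log_norm_mul_divergence (hE : 1 < finrank ℝ E) {ζ : E → E}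
    (hζ : ContDiff ℝ 1 ζ) (hs : HasCompactSupport ζ) :
    ∫ x, Real.log ‖x‖ * divergence ζ x ∂μ = -∫ x, ⟪x, ζ x⟫ / ‖x‖ ^ 2 ∂μ := by
  have hL := tendsto_integral_half_log_mul (μ := μ) hE (continuous_divergence hζ)
    (hasCompactSupport_divergence hs)
  have hR := (tendsto_integral_inner_div_norm_sq_add (μ := μ) hE hζ.continuous hs).neg
  refine tendsto_nhds_unique hL (hR.congr' ?_)
  filter_upwards [self_mem_nhdsWithin] with ε hε
  rw [integral_mul_divergence (contDiff_half_log_norm_sq_add hε) hζ hs]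
  simp_rw [fderiv_half_log_norm_sq_add hε]

theorem integral_log_norm_sub_mul_divergence (hE : 1 < finrank ℝ E) {ζ : E → E}
    (hζ : ContDiff ℝ 1 ζ) (hs : HasCompactSupport ζ) (y : E) :
    ∫ x, Real.log ‖x - y‖ * divergence ζ x ∂μ = -∫ x, ⟪x - y, ζ x⟫ / ‖x - y‖ ^ 2 ∂μ := by
  have h := integral_log_norm_mul_divergence (μ := μ) hE (ζ := fun x => ζ (x + y))
    (hζ.comp (contDiff_id.add contDiff_const)) (hs.comp_homeomorph (Homeomorph.addRight y))
  simp only [divergence, fderiv_comp_add_right] at h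
  rw [← integral_add_right_eq_self _ y, ← integral_add_right_eq_self (fun x => _ / _) y]
  simpa only [add_sub_cancel_right, divergence] using h

theorem integral_log_div_norm_sub_mul_divergence (hE : 1 < finrank ℝ E) {ζ : E → E}
    (hζ : ContDiff ℝ 1 ζ) (hs : HasCompactSupport ζ) {y : E} (hy : y ≠ 0) :
    ∫ x, Real.log (‖y‖ / ‖x - y‖) * divergence ζ x ∂μ =
      ∫ x, ⟪x - y, ζ x⟫ / ‖x - y‖ ^ 2 ∂μ := by
  have hc := continuous_divergence hζ
  have hs' := hasCompactSupport_divergence hs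
  have hdiv : Integrable (divergence ζ) μ := hc.integrable_of_hasCompactSupport hs'
  have hlog : Integrable (fun x => Real.log ‖x - y‖ * divergence ζ x) μ := by
    simpa only [sub_add_cancel] using (integrable_log_norm_mul (μ := μ) hE
      (h := fun x => divergence ζ (x + y)) (hc.comp (continuous_add_const y))
      (hs'.comp_homeomorph (Homeomorph.addRight y))).comp_sub_right y
  have : Nontrivial E := nontrivial_of_finrank_pos (R := ℝ) (by omega)
  calc ∫ x, Real.log (‖y‖ / ‖x - y‖) * divergence ζ x ∂μ
      = ∫ x, (Real.log ‖y‖ * divergence ζ x - Real.log ‖x - y‖ * divergence ζ x) ∂μ := by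
        refine integral_congr_ae ?_
        filter_upwards [μ.ae_ne y] with x hx
        rw [Real.log_div (norm_ne_zero_iff.2 hy) (norm_ne_zero_iff.2 (sub_ne_zero.2 hx)), sub_mul]
    _ = ∫ x, ⟪x - y, ζ x⟫ / ‖x - y‖ ^ 2 ∂μ := by
        rw [integral_sub (hdiv.const_mul _) hlog, integral_const_mul,
          integral_divergence_eq_zero hζ hs, integral_log_norm_sub_mul_divergence hE hζ hs y]
        ring

end LogarithmicSingularity

section Pohozaev

/-- The logarithmic potential of the density `ρ`, normalised to vanish at the origin. -/
noncomputable def logPotential {E : Type*} [NormedAddCommGroup E] [MeasurableSpace E]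
    (μ : Measure E) (ρ : E → ℝ) (x : E) : ℝ :=
  ∫ y, Real.log (‖y‖ / ‖x - y‖) * ρ y ∂μ

variable {E : Type*} [NormedAddCommGroup E] [InnerProductSpace ℝ E] [FiniteDimensional ℝ E]

section Kernel

variable [MeasurableSpace E] [BorelSpace E] {μ : Measure E} [μ.IsAddHaarMeasure]
  {v ρ : E → ℝ} {ξ : E → E} {a C : ℝ}

theorem integrable_inner_kernel (hE : 1 < finrank ℝ E) (hρ : Integrable ρ μ)
    (hξ : Continuous ξ) (hs : HasCompactSupport ξ) :
    Integrable (fun p : E × E => ⟪p.1 - p.2, ξ p.1⟫ / ‖p.1 - p.2‖ ^ 2 * ρ p.2) (μ.prod μ) := by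
  refine (integrable_fst_mul_of_hasCompactSupport hξ.norm hs.norm
    (integrable_inv_norm_sub_mul_prod hE hs.norm.isCompact.measure_lt_top.ne hρ.norm)).mono'
    (AEStronglyMeasurable.mul (Measurable.aestronglyMeasurable ?_)
      hρ.aestronglyMeasurable.comp_snd) (Eventually.of_forall fun p => ?_)
  · have := hξ.measurable
    fun_prop
  · rw [norm_mul, ← mul_assoc, norm_div, norm_pow, norm_norm]
    gcongr
    calc ‖⟪p.1 - p.2, ξ p.1⟫‖ / ‖p.1 - p.2‖ ^ 2 ≤ ‖p.1 - p.2‖ * ‖ξ p.1‖ / ‖p.1 - p.2‖ ^ 2 := by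
          gcongr; exact norm_inner_le_norm _ _
      _ = ‖ξ p.1‖ * ‖p.1 - p.2‖⁻¹ := by field_simp

theorem integral_fderiv_logPotential (hE : 1 < finrank ℝ E) (hv : ContDiff ℝ 1 v)
    (hρc : Continuous ρ) (hρ : Integrable ρ μ) (hvρ : ∀ x, v x = a * logPotential μ ρ x + C)
    (hξ : ContDiff ℝ 1 ξ) (hs : HasCompactSupport ξ) :
    ∫ x, fderiv ℝ v x (ξ x) ∂μ =
      -a * ∫ p : E × E, ⟪p.1 - p.2, ξ p.1⟫ / ‖p.1 - p.2‖ ^ 2 * ρ p.2 ∂μ.prod μ := by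
  have hc := continuous_divergence hξ
  have hs' := hasCompactSupport_divergence hs
  have : Nontrivial E := nontrivial_of_finrank_pos (R := ℝ) (by omega)
  have hprod : Integrable (fun p : E × E => divergence ξ p.1 *
      (Real.log (‖p.2‖ / ‖p.1 - p.2‖) * ρ p.2)) (μ.prod μ) :=
    integrable_fst_mul_of_hasCompactSupport hc hs'
      (integrable_log_mul_prod hE hs'.isCompact hρc hρ)
  have hpot : ∫ x, logPotential μ ρ x * divergence ξ x ∂μ =
      ∫ p : E × E, ⟪p.1 - p.2, ξ p.1⟫ / ‖p.1 - p.2‖ ^ 2 * ρ p.2 ∂μ.prod μ := by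
    simp_rw [logPotential, mul_comm _ (divergence ξ _), ← integral_const_mul]
    rw [integral_integral_swap hprod,
      integral_prod_symm _ (integrable_inner_kernel hE hρ hξ.continuous hs)]
    refine integral_congr_ae ?_
    filter_upwards [μ.ae_ne 0] with y hy
    simp_rw [integral_mul_const, ← integral_log_div_norm_sub_mul_divergence hE hξ hs hy,
      ← integral_mul_const]
    congr 1 with x
    ring
  have hpot_int : Integrable (fun x => logPotential μ ρ x * divergence ξ x) μ := by
    simpa only [logPotential, integral_const_mul, mul_comm] using hprod.integral_prod_left
  rw [← hpot, ← neg_neg (∫ x, fderiv ℝ v x (ξ x) ∂μ), ← integral_mul_divergence hv hξ hs]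
  simp_rw [hvρ, add_mul, mul_assoc]
  rw [integral_add (hpot_int.const_mul a)
    ((hc.integrable_of_hasCompactSupport hs').const_mul C), integral_const_mul,
    integral_const_mul, integral_divergence_eq_zero hξ hs]
  ring

theorem integral_fderiv_logPotential_mul (hE : 1 < finrank ℝ E) (hv : ContDiff ℝ 1 v)
    (hρc : ContDiff ℝ 1 ρ) (hρ : Integrable ρ μ) (hvρ : ∀ x, v x = a * logPotential μ ρ x + C)
    (hξ : ContDiff ℝ 1 ξ) (hs : HasCompactSupport ξ) :
    ∫ x, fderiv ℝ v x (ξ x) * ρ x ∂μ =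
      -(a / 2) * ∫ p : E × E, ⟪ξ p.1 - ξ p.2, p.1 - p.2⟫ / ‖p.1 - p.2‖ ^ 2 * (ρ p.1 * ρ p.2)
        ∂μ.prod μ := by
  set F : E × E → ℝ := fun p => ⟪p.1 - p.2, ρ p.1 • ξ p.1⟫ / ‖p.1 - p.2‖ ^ 2 * ρ p.2 with hF_def
  have hsρ : HasCompactSupport fun x => ρ x • ξ x := hs.smul_left
  have hF : Integrable F (μ.prod μ) :=
    integrable_inner_kernel hE hρ (hρc.continuous.smul hξ.continuous) hsρ
  have hsymm (p : E × E) :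
      ⟪ξ p.1 - ξ p.2, p.1 - p.2⟫ / ‖p.1 - p.2‖ ^ 2 * (ρ p.1 * ρ p.2) = F p + F p.swap := by
    simp only [hF_def, Prod.fst_swap, Prod.snd_swap]
    rw [norm_sub_rev p.2 p.1, ← neg_sub p.1 p.2, inner_neg_left, inner_smul_right,
      inner_smul_right, inner_sub_left, real_inner_comm (ξ p.1), real_inner_comm (ξ p.2)]
    ring
  calc ∫ x, fderiv ℝ v x (ξ x) * ρ x ∂μ = ∫ x, fderiv ℝ v x (ρ x • ξ x) ∂μ := by
        simp_rw [map_smul, smul_eq_mul, mul_comm]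
    _ = -a * ∫ p, F p ∂μ.prod μ :=
        integral_fderiv_logPotential hE hv hρc.continuous hρ hvρ (hρc.smul hξ) hsρ
    _ = -(a / 2) * ∫ p, (F p + F p.swap) ∂μ.prod μ := by
        have hFswap : Integrable (fun p : E × E => F p.swap) (μ.prod μ) := hF.swap
        rw [integral_add hF hFswap, integral_prod_swap F]
        ring
    _ = _ := by simp_rw [hsymm]

theorem integral_exp_mul_divergence_smul (hE : 1 < finrank ℝ E) {Q : E → ℝ}
    (hv : ContDiff ℝ 1 v) (hQ : ContDiff ℝ 1 Q)
    (hρ : Integrable (fun x => Q x * Real.exp (v x)) μ)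
    (hvρ : ∀ x, v x = a * logPotential μ (fun x => Q x * Real.exp (v x)) x + C)
    (hξ : ContDiff ℝ 1 ξ) (hs : HasCompactSupport ξ) :
    ∫ x, Real.exp (v x) * divergence (fun y => Q y • ξ y) x ∂μ =
      a / 2 * ∫ p : E × E, ⟪ξ p.1 - ξ p.2, p.1 - p.2⟫ / ‖p.1 - p.2‖ ^ 2 *
        (Q p.1 * Real.exp (v p.1) * (Q p.2 * Real.exp (v p.2))) ∂μ.prod μ := by
  rw [integral_mul_divergence hv.exp (hQ.fun_smul hξ) hs.smul_left]
  have hgrad (x : E) : fderiv ℝ (fun x => Real.exp (v x)) x (Q x • ξ x) =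
      fderiv ℝ v x (ξ x) * (Q x * Real.exp (v x)) := by
    rw [fderiv_exp (hv.differentiable one_ne_zero x)]
    simp only [map_smul, smul_apply, smul_eq_mul]
    ring
  simp_rw [hgrad]
  rw [integral_fderiv_logPotential_mul hE hv (hQ.mul hv.exp) hρ hvρ hξ hs]
  ring

end Kernel

/-- The vector field `x ↦ x - x₀`, cut off at distance of order `R` from `x₀`. -/
noncomputable def cutoffField (φ : ContDiffBump (0 : E)) (x₀ : E) (R : ℝ) (x : E) : E :=
  φ (R⁻¹ • (x - x₀)) • (x - x₀)

namespace cutoffField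

variable (φ : ContDiffBump (0 : E)) (x₀ : E)

theorem contDiff (R : ℝ) : ContDiff ℝ 1 (cutoffField φ x₀ R) := by
  have hsub : ContDiff ℝ 1 fun x : E => x - x₀ := contDiff_id.sub contDiff_const
  exact (φ.contDiff.comp (hsub.const_smul R⁻¹)).smul hsub

theorem hasCompactSupport {R : ℝ} (hR : 0 < R) : HasCompactSupport (cutoffField φ x₀ R) := by
  refine HasCompactSupport.intro (isCompact_closedBall x₀ (φ.rOut * R)) fun x hx => ?_
  rw [mem_closedBall, dist_eq_norm, not_le] at hx
  rw [cutoffField, φ.zero_of_le_dist, zero_smul]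
  rw [dist_zero_right, norm_smul, norm_inv, Real.norm_of_nonneg hR.le, inv_mul_eq_div,
    le_div_iff₀ hR]
  exact hx.le

theorem exists_lipschitzWith :
    ∃ L : NNReal, ∀ R > 0, LipschitzWith L (cutoffField φ x₀ R) := by
  obtain ⟨L, hL⟩ := ContDiff.lipschitzWith_of_hasCompactSupport (𝕂 := ℝ)
    (hasCompactSupport φ 0 one_pos) (contDiff φ 0 1) one_ne_zero
  refine ⟨L, fun R hR => LipschitzWith.of_dist_le_mul fun x y => ?_⟩
  have hscale (x : E) : cutoffField φ x₀ R x = R • cutoffField φ 0 1 (R⁻¹ • (x - x₀)) := by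
    simp only [cutoffField, inv_one, sub_zero, one_smul]
    rw [smul_comm, smul_inv_smul₀ hR.ne']
  calc dist (cutoffField φ x₀ R x) (cutoffField φ x₀ R y)
      ≤ R * (L * dist (R⁻¹ • (x - x₀)) (R⁻¹ • (y - x₀))) := by
        rw [hscale, hscale, dist_smul₀, Real.norm_of_nonneg hR.le]
        gcongr
        exact hL.dist_le_mul _ _
    _ = L * dist x y := by
        rw [dist_smul₀, dist_sub_right, norm_inv, Real.norm_of_nonneg hR.le]
        field_simp

theorem eventually_eventuallyEq (x : E) :
    ∀ᶠ R in atTop, cutoffField φ x₀ R =ᶠ[𝓝 x] fun y => y - x₀ := by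
  filter_upwards [eventually_gt_atTop 0, eventually_gt_atTop (‖x - x₀‖ / φ.rIn)] with R hR hxR
  have hnear : ∀ᶠ y in 𝓝 x, ‖y - x₀‖ < φ.rIn * R :=
    ContinuousAt.eventually_lt (by fun_prop) continuousAt_const
      ((div_lt_iff₀' φ.rIn_pos).1 hxR)
  filter_upwards [hnear] with y hy
  rw [cutoffField, φ.one_of_mem_closedBall, one_smul]
  rw [mem_closedBall, dist_zero_right, norm_smul, norm_inv, Real.norm_of_nonneg hR.le,
    inv_mul_eq_div, div_le_iff₀ hR]
  exact hy.le

variable [MeasurableSpace E] [BorelSpace E] {μ : Measure E}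

theorem tendsto_integral_divergence {Q w : E → ℝ} (hQ : ContDiff ℝ 1 Q) (hw : Continuous w)
    (hρ : Integrable (fun x => Q x * w x) μ)
    (hW : Integrable (fun x => fderiv ℝ Q x (x - x₀) * w x) μ) :
    Tendsto (fun R => ∫ x, w x * divergence (fun y => Q y • cutoffField φ x₀ R y) x ∂μ) atTop
      (𝓝 (finrank ℝ E * (∫ x, Q x * w x ∂μ) + ∫ x, fderiv ℝ Q x (x - x₀) * w x ∂μ)) := by
  have hdiv (R : ℝ) (x : E) : divergence (fun y => Q y • cutoffField φ x₀ R y) x =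
      Q x * divergence (cutoffField φ x₀ R) x + fderiv ℝ Q x (cutoffField φ x₀ R x) :=
    divergence_smul (hQ.differentiable one_ne_zero x) ((contDiff φ x₀ R).differentiable
      one_ne_zero x)
  rw [← integral_const_mul, ← integral_add (hρ.const_mul _) hW]
  obtain ⟨L, hL⟩ := exists_lipschitzWith φ x₀
  refine tendsto_integral_filter_of_dominated_convergence
    (fun x => finrank ℝ E * L * ‖Q x * w x‖ + ‖fderiv ℝ Q x (x - x₀) * w x‖)
    (Eventually.of_forall fun R => ?_) ?_ ((hρ.norm.const_mul _).add hW.norm) ?_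
  · exact (hw.mul (continuous_divergence (hQ.smul (contDiff φ x₀ R)))).aestronglyMeasurable
  · filter_upwards [eventually_gt_atTop 0] with R hR
    refine Eventually.of_forall fun x => ?_
    have hφ : |φ (R⁻¹ • (x - x₀))| ≤ 1 := by
      rw [abs_of_nonneg φ.nonneg]
      exact φ.le_one
    rw [hdiv, mul_add]
    refine (norm_add_le _ _).trans (add_le_add ?_ ?_)
    · calc ‖w x * (Q x * divergence (cutoffField φ x₀ R) x)‖
          = |divergence (cutoffField φ x₀ R) x| * ‖Q x * w x‖ := by
            simp only [norm_mul, Real.norm_eq_abs]; ring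
        _ ≤ _ := by gcongr; exact abs_divergence_le (hL R hR) x
    · calc ‖w x * fderiv ℝ Q x (cutoffField φ x₀ R x)‖
          = |φ (R⁻¹ • (x - x₀))| * ‖fderiv ℝ Q x (x - x₀) * w x‖ := by
            simp only [cutoffField, map_smul, smul_eq_mul, norm_mul, Real.norm_eq_abs]; ring
        _ ≤ _ := mul_le_of_le_one_left (norm_nonneg _) hφ
  · refine Eventually.of_forall fun x => tendsto_const_nhds.congr' ?_
    filter_upwards [eventually_eventuallyEq φ x₀ x] with R hR
    have hdivR : divergence (cutoffField φ x₀ R) x = finrank ℝ E := by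
      rw [← divergence_sub_const x₀ x, divergence, divergence, hR.fderiv_eq]
    rw [hdiv, hdivR, hR.eq_of_nhds]
    ring

variable [μ.IsAddHaarMeasure]

theorem tendsto_integral_inner (hE : 0 < finrank ℝ E) {ρ : E → ℝ} (hρ : Integrable ρ μ) :
    Tendsto (fun R => ∫ p : E × E, ⟪cutoffField φ x₀ R p.1 - cutoffField φ x₀ R p.2, p.1 - p.2⟫ /
      ‖p.1 - p.2‖ ^ 2 * (ρ p.1 * ρ p.2) ∂μ.prod μ) atTop (𝓝 ((∫ x, ρ x ∂μ) ^ 2)) := by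
  have : Nontrivial E := nontrivial_of_finrank_pos hE
  rw [sq, ← integral_prod_mul]
  obtain ⟨L, hL⟩ := exists_lipschitzWith φ x₀
  refine tendsto_integral_filter_of_dominated_convergence (fun p => L * ‖ρ p.1 * ρ p.2‖)
    (Eventually.of_forall fun R => ?_) ?_ ((hρ.mul_prod hρ).norm.const_mul _) ?_
  · have := (contDiff φ x₀ R).continuous.measurable
    exact (Measurable.aestronglyMeasurable (by fun_prop)).mul (hρ.mul_prod hρ).aestronglyMeasurable
  · filter_upwards [eventually_gt_atTop 0] with R hR
    refine Eventually.of_forall fun p => ?_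
    rw [norm_mul, norm_div, norm_pow, norm_norm]
    gcongr
    refine div_le_of_le_mul₀ (by positivity) (by positivity) ((norm_inner_le_norm _ _).trans ?_)
    rw [sq, ← mul_assoc]
    gcongr
    simpa only [dist_eq_norm] using (hL R hR).dist_le_mul p.1 p.2
  · have hne : ∀ᵐ p ∂μ.prod μ, p.1 ≠ p.2 :=
      (Measure.ae_prod_iff_ae_ae (measurableSet_eq_fun measurable_fst measurable_snd).compl).2
        (Eventually.of_forall fun x => (μ.ae_ne x).mono fun y => Ne.symm)
    filter_upwards [hne] with p hp
    refine tendsto_const_nhds.congr' ?_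
    filter_upwards [eventually_eventuallyEq φ x₀ p.1, eventually_eventuallyEq φ x₀ p.2]
      with R h₁ h₂
    rw [h₁.eq_of_nhds, h₂.eq_of_nhds, sub_sub_sub_cancel_right, real_inner_self_eq_norm_sq,
      div_self (pow_ne_zero 2 (norm_ne_zero_iff.2 (sub_ne_zero.2 hp))), one_mul]

end cutoffField

theorem pohozaev_identity [MeasurableSpace E] [BorelSpace E] {μ : Measure E} [μ.IsAddHaarMeasure]
    (hE : 1 < finrank ℝ E) {v Q : E → ℝ} {a C : ℝ} (x₀ : E) (hv : ContDiff ℝ 1 v)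
    (hQ : ContDiff ℝ 1 Q) (hρ : Integrable (fun x => Q x * Real.exp (v x)) μ)
    (hvρ : ∀ x, v x = a * logPotential μ (fun x => Q x * Real.exp (v x)) x + C)
    (hW : Integrable (fun x => fderiv ℝ Q x (x - x₀) * Real.exp (v x)) μ) :
    finrank ℝ E * (∫ x, Q x * Real.exp (v x) ∂μ) + ∫ x, fderiv ℝ Q x (x - x₀) * Real.exp (v x) ∂μ =
      a / 2 * (∫ x, Q x * Real.exp (v x) ∂μ) ^ 2 := by
  set φ : ContDiffBump (0 : E) := default
  refine tendsto_nhds_unique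
    (cutoffField.tendsto_integral_divergence φ x₀ hQ hv.continuous.rexp hρ hW)
    (((cutoffField.tendsto_integral_inner φ x₀ (by omega) hρ).const_mul (a / 2)).congr' ?_)
  filter_upwards [eventually_gt_atTop 0] with R hR
  exact (integral_exp_mul_divergence_smul hE hv hQ hρ hvρ (cutoffField.contDiff φ x₀ R)
    (cutoffField.hasCompactSupport φ x₀ hR)).symm

end Pohozaev

section Growth

/-- The mean over `x ∈ K` of the normalised logarithmic kernel `log (‖y‖ / ‖x - y‖)`. -/
noncomputable def logKernelMean {E : Type*} [NormedAddCommGroup E] [MeasurableSpace E]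
    (μ : Measure E) (K : Set E) (y : E) : ℝ :=
  ⨍ x in K, Real.log (‖y‖ / ‖x - y‖) ∂μ

theorem abs_log_div_norm_sub_add_posLog_le {E : Type*} [NormedAddCommGroup E] {x y : E}
    (hxy : x ≠ y) :
    |Real.log (‖y‖ / ‖x - y‖) + Real.posLog ‖y‖⁻¹| ≤ (1 + ‖x‖) * (1 + ‖x - y‖⁻¹) := by
  have ht : 0 < ‖x - y‖ := norm_pos_iff.2 (sub_ne_zero.2 hxy)
  rcases eq_or_ne y 0 with rfl | hy
  · simp only [norm_zero, zero_div, Real.log_zero, inv_zero, Real.posLog_zero, add_zero, abs_zero]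
    positivity
  have hmax : (1 : ℝ) ≤ max 1 ‖y‖ := le_max_left _ _
  have hrw : Real.log (‖y‖ / ‖x - y‖) + Real.posLog ‖y‖⁻¹ = Real.log (max 1 ‖y‖ / ‖x - y‖) := by
    rw [Real.log_div (norm_ne_zero_iff.2 hy) ht.ne', Real.log_div (by positivity) ht.ne',
      ← Real.posLog_eq_log_max_one (norm_nonneg y), ← Real.posLog_sub_posLog_inv (x := ‖y‖)]
    ring
  have hupper : max 1 ‖y‖ / ‖x - y‖ ≤ 1 + (1 + ‖x‖) * ‖x - y‖⁻¹ := by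
    have hy_le : ‖y‖ ≤ ‖x‖ + ‖x - y‖ := by simpa using norm_sub_le x (x - y)
    have : max 1 ‖y‖ ≤ ‖x - y‖ + (1 + ‖x‖) := max_le (by linarith [norm_nonneg x]) (by linarith)
    calc max 1 ‖y‖ / ‖x - y‖ ≤ (‖x - y‖ + (1 + ‖x‖)) / ‖x - y‖ := by gcongr
      _ = 1 + (1 + ‖x‖) * ‖x - y‖⁻¹ := by rw [add_div, div_self ht.ne', div_eq_mul_inv]
  have hlower : (max 1 ‖y‖ / ‖x - y‖)⁻¹ ≤ 1 + ‖x‖ := by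
    rw [inv_div, div_le_iff₀ (by positivity)]
    nlinarith [norm_sub_le x y, le_max_right 1 ‖y‖, norm_nonneg x]
  have hpos : 0 < max 1 ‖y‖ / ‖x - y‖ := by positivity
  have hlog := Real.log_le_sub_one_of_pos hpos
  have hlog_inv := Real.log_le_sub_one_of_pos (inv_pos.2 hpos)
  rw [Real.log_inv] at hlog_inv
  have : 0 ≤ (1 + ‖x‖) * ‖x - y‖⁻¹ := by positivity
  rw [hrw, abs_le]
  constructor <;> linarith [norm_nonneg x]

theorem posLog_mul_le_log_add_self {s t : ℝ} (hs : 1 ≤ s) (ht : 0 ≤ t) :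
    Real.posLog (s * t) ≤ Real.log s + t := by
  have hst : Real.posLog t ≤ t := max_le ht (Real.log_le_self ht)
  have hlog : Real.posLog s = Real.log s := Real.posLog_eq_log (hs.trans (le_abs_self s))
  linarith [Real.posLog_mul (x := s) (y := t)]

variable {E : Type*} [NormedAddCommGroup E] [NormedSpace ℝ E] [FiniteDimensional ℝ E]
  [MeasurableSpace E] [BorelSpace E] {μ : Measure E} [μ.IsAddHaarMeasure] {K : Set E}
  {v Q ρ : E → ℝ} {a C R : ℝ}

theorem integrableOn_log_div_norm_sub (hE : 1 < finrank ℝ E) (hK : IsCompact K) (y : E) :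
    IntegrableOn (fun x => Real.log (‖y‖ / ‖x - y‖)) K μ := by
  obtain ⟨c, hc⟩ := hK.isBounded.exists_norm_le
  have hconst : IntegrableOn (fun _ : E => ‖y‖⁻¹) K μ := integrableOn_const hK.measure_lt_top.ne
  refine Integrable.mono' (((integrableOn_inv_norm_sub hE hK.measure_lt_top.ne y).add
    hconst).const_mul c) (Measurable.aestronglyMeasurable (by fun_prop)) ?_
  filter_upwards [ae_restrict_mem hK.measurableSet] with x hx
  exact (abs_log_div_norm_sub_le x y).trans
    (mul_le_mul_of_nonneg_right (hc x hx) (by positivity))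

theorem exists_abs_logKernelMean_add_posLog_le (hE : 1 < finrank ℝ E) (hK : IsCompact K)
    (hμK : μ K ≠ 0) :
    ∃ M, ∀ y, |logKernelMean μ K y + Real.posLog ‖y‖⁻¹| ≤ M := by
  have : Nontrivial E := nontrivial_of_finrank_pos (R := ℝ) (by omega)
  have hμK' : μ K ≠ ⊤ := hK.measure_lt_top.ne
  have hm : 0 < μ.real K := ENNReal.toReal_pos hμK hμK'
  obtain ⟨c, hc⟩ := hK.isBounded.exists_norm_le
  obtain ⟨M, hM⟩ := exists_setIntegral_inv_norm_sub_le hE hμK'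
  refine ⟨(μ.real K)⁻¹ * ((1 + |c|) * (μ.real K + M)), fun y => ?_⟩
  have hone : IntegrableOn (fun _ : E => (1 : ℝ)) K μ := integrableOn_const hμK'
  have hinv := integrableOn_inv_norm_sub hE hμK' y
  have hmean : logKernelMean μ K y + Real.posLog ‖y‖⁻¹ =
      (μ.real K)⁻¹ * ∫ x in K, (Real.log (‖y‖ / ‖x - y‖) + Real.posLog ‖y‖⁻¹) ∂μ := by
    rw [integral_add (integrableOn_log_div_norm_sub hE hK y) (integrableOn_const hμK'),
      setIntegral_const, logKernelMean, setAverage_eq, smul_eq_mul, smul_eq_mul, mul_add,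
      inv_mul_cancel_left₀ hm.ne']
  have hbound : ‖∫ x in K, (Real.log (‖y‖ / ‖x - y‖) + Real.posLog ‖y‖⁻¹) ∂μ‖ ≤
      ∫ x in K, (1 + |c|) * (1 + ‖x - y‖⁻¹) ∂μ := by
    refine norm_integral_le_of_norm_le ((hone.add hinv).const_mul _) ?_
    filter_upwards [ae_restrict_mem hK.measurableSet, ae_restrict_of_ae (μ.ae_ne y)] with x hx hxy
    refine (abs_log_div_norm_sub_add_posLog_le hxy).trans ?_
    gcongr
    exact (hc x hx).trans (le_abs_self c)
  rw [integral_const_mul, integral_add hone hinv, setIntegral_const, smul_eq_mul,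
    mul_one] at hbound
  rw [hmean, abs_mul, abs_of_pos (inv_pos.2 hm)]
  gcongr
  refine hbound.trans ?_
  gcongr
  exact hM y

theorem tendsto_logKernelMean_inv_smul_div_log (hE : 1 < finrank ℝ E) (hK : IsCompact K)
    (hμK : μ K ≠ 0) {y : E} (hy : y ≠ 0) :
    Tendsto (fun R : ℝ => logKernelMean μ K (R⁻¹ • y) / Real.log R) atTop (𝓝 (-1)) := by
  obtain ⟨M, hM⟩ := exists_abs_logKernelMean_add_posLog_le hE hK hμK
  have hlim : Tendsto (fun R => (M + |Real.log ‖y‖|) / Real.log R) atTop (𝓝 0) :=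
    tendsto_const_nhds.div_atTop Real.tendsto_log_atTop
  rw [tendsto_iff_dist_tendsto_zero]
  refine squeeze_zero' (Eventually.of_forall fun _ => dist_nonneg) ?_ hlim
  filter_upwards [eventually_gt_atTop 0, eventually_ge_atTop ‖y‖,
    Real.tendsto_log_atTop.eventually_gt_atTop 0] with R hR hyR hlog
  have hy' : 0 < ‖y‖ := norm_pos_iff.2 hy
  have hposLog : Real.posLog ‖R⁻¹ • y‖⁻¹ = Real.log R - Real.log ‖y‖ := by
    rw [norm_smul, norm_inv, Real.norm_of_nonneg hR.le, mul_inv, inv_inv, ← div_eq_mul_inv,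
      Real.posLog_eq_log ((le_abs_self _).trans' ((one_le_div hy').2 hyR)),
      Real.log_div hR.ne' hy'.ne']
  have hbound := hM (R⁻¹ • y)
  rw [hposLog] at hbound
  rw [Real.dist_eq, sub_neg_eq_add, div_add_one hlog.ne', abs_div, abs_of_pos hlog]
  gcongr
  calc |logKernelMean μ K (R⁻¹ • y) + Real.log R|
      = |(logKernelMean μ K (R⁻¹ • y) + (Real.log R - Real.log ‖y‖)) + Real.log ‖y‖| := by
        congr 1; ring
    _ ≤ M + |Real.log ‖y‖| := (abs_add_le _ _).trans (by gcongr)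

theorem exists_abs_logKernelMean_inv_smul_le (hE : 1 < finrank ℝ E) (hK : IsCompact K)
    (hμK : μ K ≠ 0) :
    ∃ M, 0 ≤ M ∧ ∀ R : ℝ, 1 ≤ R → ∀ y,
      |logKernelMean μ K (R⁻¹ • y)| ≤ M + Real.log R + ‖y‖⁻¹ := by
  obtain ⟨M, hM⟩ := exists_abs_logKernelMean_add_posLog_le hE hK hμK
  refine ⟨M, (abs_nonneg _).trans (hM 0), fun R hR y => ?_⟩
  have hposLog : Real.posLog ‖R⁻¹ • y‖⁻¹ ≤ Real.log R + ‖y‖⁻¹ := by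
    rw [norm_smul, norm_inv, Real.norm_of_nonneg (zero_le_one.trans hR), mul_inv, inv_inv]
    exact posLog_mul_le_log_add_self hR (by positivity)
  have hM' := abs_le.1 (hM (R⁻¹ • y))
  have := Real.posLog_nonneg (x := ‖R⁻¹ • y‖⁻¹)
  have := Real.log_nonneg hR
  have : 0 ≤ ‖y‖⁻¹ := by positivity
  rw [abs_le]
  constructor <;> linarith

theorem measurable_logKernelMean : Measurable (logKernelMean μ K) := by
  have hmeas : StronglyMeasurable (Function.uncurry fun y x : E => Real.log (‖y‖ / ‖x - y‖)) :=
    Measurable.stronglyMeasurable (by fun_prop)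
  unfold logKernelMean
  simp_rw [setAverage_eq]
  exact hmeas.integral_prod_right.measurable.const_smul (μ.real K)⁻¹

theorem integrableOn_logPotential (hE : 1 < finrank ℝ E) (hK : IsCompact K) (hρc : Continuous ρ)
    (hρ : Integrable ρ μ) : IntegrableOn (logPotential μ ρ) K μ :=
  (integrable_log_mul_prod hE hK hρc hρ).integral_prod_left

theorem setAverage_logPotential (hE : 1 < finrank ℝ E) (hK : IsCompact K) (hρc : Continuous ρ)
    (hρ : Integrable ρ μ) :
    ⨍ x in K, logPotential μ ρ x ∂μ = ∫ y, logKernelMean μ K y * ρ y ∂μ := by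
  simp_rw [logPotential, logKernelMean, setAverage_eq, smul_eq_mul]
  rw [integral_integral_swap (integrable_log_mul_prod hE hK hρc hρ), ← integral_const_mul]
  simp_rw [integral_mul_const, mul_assoc]

theorem logPotential_smul (hR : 0 < R) (x : E) :
    logPotential μ ρ (R • x) = R ^ finrank ℝ E * logPotential μ (fun y => ρ (R • y)) x := by
  have hkernel (y : E) : ‖R • y‖ / ‖R • x - R • y‖ = ‖y‖ / ‖x - y‖ := by
    rw [← smul_sub, norm_smul, norm_smul, mul_div_mul_left _ _ (norm_ne_zero_iff.2 hR.ne')]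
  have hscale := μ.integral_comp_smul_of_nonneg
    (fun y => Real.log (‖y‖ / ‖R • x - y‖) * ρ y) R (hR := hR.le)
  simp_rw [hkernel] at hscale
  rw [logPotential, logPotential, hscale, smul_eq_mul, mul_inv_cancel_left₀ (by positivity)]

theorem setAverage_logPotential_smul (hE : 1 < finrank ℝ E) (hK : IsCompact K)
    (hρc : Continuous ρ) (hρ : Integrable ρ μ) (hR : 0 < R) :
    ⨍ x in K, logPotential μ ρ (R • x) ∂μ = ∫ y, logKernelMean μ K (R⁻¹ • y) * ρ y ∂μ := by
  have hscale := μ.integral_comp_smul_of_nonneg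
    (fun y => logKernelMean μ K (R⁻¹ • y) * ρ y) R (hR := hR.le)
  simp_rw [inv_smul_smul₀ hR.ne', smul_eq_mul] at hscale
  simp_rw [logPotential_smul hR, setAverage_eq, integral_const_mul, smul_eq_mul,
    mul_left_comm _ (R ^ finrank ℝ E), ← smul_eq_mul (μ.real K)⁻¹, ← setAverage_eq]
  rw [setAverage_logPotential hE hK (by fun_prop) (hρ.comp_smul hR.ne'), hscale,
    mul_inv_cancel_left₀ (by positivity)]

theorem tendsto_setAverage_logPotential_smul_div_log (hE : 1 < finrank ℝ E) (hK : IsCompact K)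
    (hμK : μ K ≠ 0) (hρc : Continuous ρ) (hρ : Integrable ρ μ) :
    Tendsto (fun R : ℝ => (⨍ x in K, logPotential μ ρ (R • x) ∂μ) / Real.log R) atTop
      (𝓝 (-∫ y, ρ y ∂μ)) := by
  obtain ⟨M, hM0, hM⟩ := exists_abs_logKernelMean_inv_smul_le hE hK hμK
  have : Nontrivial E := nontrivial_of_finrank_pos (R := ℝ) (by omega)
  have hlim : Tendsto (fun R : ℝ => ∫ y, logKernelMean μ K (R⁻¹ • y) / Real.log R * ρ y ∂μ) atTop
      (𝓝 (∫ y, -1 * ρ y ∂μ)) := by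
    refine tendsto_integral_filter_of_dominated_convergence
      (fun y => (M + 1) * |ρ y| + ‖y‖⁻¹ * |ρ y|) (Eventually.of_forall fun R => ?_) ?_
      ((hρ.abs.const_mul _).add (integrable_inv_norm_mul hE hρc.abs hρ.abs)) ?_
    · exact ((measurable_logKernelMean.comp (measurable_const_smul R⁻¹)).div_const
        _).aestronglyMeasurable.mul hρ.aestronglyMeasurable
    · filter_upwards [eventually_ge_atTop 1, Real.tendsto_log_atTop.eventually_ge_atTop 1]
        with R hR hlog
      refine Eventually.of_forall fun y => ?_
      rw [norm_mul, norm_div, ← add_mul, Real.norm_of_nonneg (zero_le_one.trans hlog),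
        Real.norm_eq_abs, Real.norm_eq_abs]
      gcongr
      rw [div_le_iff₀ (one_pos.trans_le hlog)]
      have : 0 ≤ ‖y‖⁻¹ := by positivity
      nlinarith [hM R hR y]
    · filter_upwards [μ.ae_ne 0] with y hy
      exact (tendsto_logKernelMean_inv_smul_div_log hE hK hμK hy).mul_const _
  rw [integral_const_mul, neg_one_mul] at hlim
  refine hlim.congr' ?_
  filter_upwards [eventually_gt_atTop 0] with R hR
  rw [setAverage_logPotential_smul hE hK hρc hρ hR, ← integral_div]
  simp only [div_mul_eq_mul_div]

theorem tendsto_setAverage_comp_smul_div_log (hE : 1 < finrank ℝ E) (hK : IsCompact K)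
    (hμK : μ K ≠ 0) (hρc : Continuous ρ) (hρ : Integrable ρ μ)
    (hvρ : ∀ x, v x = a * logPotential μ ρ x + C) :
    Tendsto (fun R : ℝ => (⨍ x in K, v (R • x) ∂μ) / Real.log R) atTop
      (𝓝 (-(a * ∫ y, ρ y ∂μ))) := by
  have hC : Tendsto (fun R : ℝ => C / Real.log R) atTop (𝓝 0) :=
    tendsto_const_nhds.div_atTop Real.tendsto_log_atTop
  have hlim :=
    ((tendsto_setAverage_logPotential_smul_div_log hE hK hμK hρc hρ).const_mul a).add hC
  rw [add_zero, mul_neg] at hlim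
  refine hlim.congr' ?_
  filter_upwards [eventually_gt_atTop 0] with R hR
  have hm : μ.real K ≠ 0 := (ENNReal.toReal_pos hμK hK.measure_lt_top.ne).ne'
  have hint : IntegrableOn (fun x => logPotential μ ρ (R • x)) K μ := by
    simp_rw [logPotential_smul hR]
    exact (integrableOn_logPotential hE hK (by fun_prop) (hρ.comp_smul hR.ne')).const_mul _
  simp_rw [setAverage_eq, hvρ]
  rw [integral_add (hint.const_mul a) (integrableOn_const hK.measure_lt_top.ne),
    integral_const_mul, setIntegral_const]
  simp only [smul_eq_mul]
  field_simp

theorem mul_exp_setAverage_comp_smul_le {c : ℝ} (hK : IsCompact K) (hμK : μ K ≠ 0)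
    (hv : Continuous v) (hρ : Integrable (fun x => Q x * Real.exp (v x)) μ) (hR : 0 < R)
    (hc : 0 ≤ c) (hQ : ∀ x ∈ K, c ≤ |Q (R • x)|) :
    c * μ.real K * R ^ finrank ℝ E * Real.exp (⨍ x in K, v (R • x) ∂μ) ≤
      ∫ x, |Q x * Real.exp (v x)| ∂μ := by
  have hμK' : μ K ≠ ⊤ := hK.measure_lt_top.ne
  have hm : μ.real K ≠ 0 := (ENNReal.toReal_pos hμK hμK').ne'
  have hv_int : IntegrableOn (fun x => v (R • x)) K μ :=
    ContinuousOn.integrableOn_compact hK (by fun_prop)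
  have hexp_int : IntegrableOn (fun x => Real.exp (v (R • x))) K μ :=
    ContinuousOn.integrableOn_compact hK (by fun_prop)
  have hρR : Integrable (fun x => |Q (R • x) * Real.exp (v (R • x))|) μ :=
    (hρ.comp_smul hR.ne').abs
  have hjensen : Real.exp (⨍ x in K, v (R • x) ∂μ) ≤
      (μ.real K)⁻¹ * ∫ x in K, Real.exp (v (R • x)) ∂μ := by
    rw [← smul_eq_mul, ← setAverage_eq]
    exact convexOn_exp.map_set_average_le Real.continuous_exp.continuousOn isClosed_univ hμK hμK'
      (by simp) hv_int hexp_int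
  have hscale := μ.integral_comp_smul_of_nonneg (fun x => |Q x * Real.exp (v x)|) R (hR := hR.le)
  calc c * μ.real K * R ^ finrank ℝ E * Real.exp (⨍ x in K, v (R • x) ∂μ)
      ≤ c * μ.real K * R ^ finrank ℝ E *
          ((μ.real K)⁻¹ * ∫ x in K, Real.exp (v (R • x)) ∂μ) := by gcongr
    _ = R ^ finrank ℝ E * ∫ x in K, c * Real.exp (v (R • x)) ∂μ := by
        rw [integral_const_mul]; field_simp
    _ ≤ R ^ finrank ℝ E * ∫ x in K, |Q (R • x) * Real.exp (v (R • x))| ∂μ := by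
        refine mul_le_mul_of_nonneg_left (setIntegral_mono_on (hexp_int.const_mul c)
          hρR.integrableOn hK.measurableSet fun x hx => ?_) (by positivity)
        rw [abs_mul, Real.abs_exp]
        exact mul_le_mul_of_nonneg_right (hQ x hx) (Real.exp_pos _).le
    _ ≤ R ^ finrank ℝ E * ∫ x, |Q (R • x) * Real.exp (v (R • x))| ∂μ := by
        refine mul_le_mul_of_nonneg_left (setIntegral_le_integral hρR ?_) (by positivity)
        exact Eventually.of_forall fun x => abs_nonneg _
    _ = ∫ x, |Q x * Real.exp (v x)| ∂μ := by
        rw [hscale, smul_eq_mul, mul_inv_cancel_left₀ (by positivity)]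

theorem finrank_add_le_of_growth (hE : 1 < finrank ℝ E) (hK : IsCompact K) (hμK : μ K ≠ 0)
    (hv : Continuous v) (hQ : Continuous Q) (hρ : Integrable (fun x => Q x * Real.exp (v x)) μ)
    (hvρ : ∀ x, v x = a * logPotential μ (fun x => Q x * Real.exp (v x)) x + C) {m : ℕ} {κ : ℝ}
    (hκ : 0 < κ) (hgrowth : ∀ᶠ R : ℝ in atTop, ∀ x ∈ K, κ * R ^ m ≤ |Q (R • x)|) :
    (finrank ℝ E : ℝ) + m ≤ a * ∫ x, Q x * Real.exp (v x) ∂μ := by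
  have hm : 0 < μ.real K := ENNReal.toReal_pos hμK hK.measure_lt_top.ne
  set D := Real.log (∫ x, |Q x * Real.exp (v x)| ∂μ) - Real.log (κ * μ.real K)
  have hmean := (tendsto_setAverage_comp_smul_div_log hE hK hμK (by fun_prop) hρ hvρ).const_add
    ((finrank ℝ E : ℝ) + m)
  have hzero : Tendsto (fun R : ℝ => D / Real.log R) atTop (𝓝 0) :=
    tendsto_const_nhds.div_atTop Real.tendsto_log_atTop
  suffices h : ∀ᶠ R : ℝ in atTop, (finrank ℝ E : ℝ) + m +
      (⨍ x in K, v (R • x) ∂μ) / Real.log R ≤ D / Real.log R by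
    linarith [le_of_tendsto_of_tendsto hmean hzero h]
  filter_upwards [hgrowth, eventually_gt_atTop 0, Real.tendsto_log_atTop.eventually_gt_atTop 0]
    with R hQR hR hlog
  have hle := Real.log_le_log (by positivity)
    (mul_exp_setAverage_comp_smul_le hK hμK hv hρ hR (by positivity) hQR)
  rw [show κ * R ^ m * μ.real K * R ^ finrank ℝ E = κ * μ.real K * R ^ (finrank ℝ E + m) by ring,
    Real.log_mul (by positivity) (by positivity), Real.log_exp,
    Real.log_mul (by positivity) (by positivity), Real.log_pow, Nat.cast_add] at hle
  rw [add_div' _ _ _ hlog.ne']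
  gcongr
  linarith

end Growth

section Polynomial

open MvPolynomial

theorem eval_smul_of_isHomogeneous {σ R : Type*} [CommSemiring R] {Q : MvPolynomial σ R} {n : ℕ}
    (hQ : Q.IsHomogeneous n) (t : R) (x : σ → R) : eval (t • x) Q = t ^ n * eval x Q := by
  rw [eval_eq, eval_eq, Finset.mul_sum]
  refine Finset.sum_congr rfl fun d hd => ?_
  have hdeg : ∑ i ∈ d.support, d i = n := by
    rw [← hQ (mem_support_iff.1 hd)]
    exact DFunLike.congr_fun Finsupp.degree_eq_weight_one d
  simp only [Pi.smul_apply, smul_eq_mul, mul_pow, Finset.prod_mul_distrib,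
    Finset.prod_pow_eq_pow_sum, hdeg]
  ring

theorem homogeneousComponent_totalDegree_ne_zero {σ R : Type*} [CommSemiring R]
    {Q : MvPolynomial σ R} (hQ : Q ≠ 0) : homogeneousComponent Q.totalDegree Q ≠ 0 := by
  obtain ⟨d, hd, hdeg⟩ := Finset.exists_mem_eq_sup Q.support (support_nonempty.2 hQ)
    (fun s => s.sum fun _ e => e)
  have hdeg' : d.degree = Q.totalDegree := hdeg.symm
  refine ne_zero_iff.2 ⟨d, ?_⟩
  rw [coeff_homogeneousComponent, if_pos hdeg']
  exact mem_support_iff.1 hd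

variable {σ : Type*} {Q : MvPolynomial σ ℝ}

theorem exists_eval_homogeneousComponent_totalDegree_ne_zero (hQ : Q ≠ 0) :
    ∃ p, eval p (homogeneousComponent Q.totalDegree Q) ≠ 0 := by
  by_contra! h
  exact homogeneousComponent_totalDegree_ne_zero hQ
    ((homogeneousComponent_isHomogeneous _ Q).eq_zero_of_forall_eval_eq_zero h)

theorem tendsto_eval_smul_div_pow (Q : MvPolynomial σ ℝ) (p : σ → ℝ) :
    Tendsto (fun q : ℝ × (σ → ℝ) => eval (q.1 • q.2) Q / q.1 ^ Q.totalDegree) (atTop ×ˢ 𝓝 p)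
      (𝓝 (eval p (homogeneousComponent Q.totalDegree Q))) := by
  set m := Q.totalDegree
  have hcomp (k : ℕ) : Tendsto (fun q : ℝ × (σ → ℝ) => eval q.2 (homogeneousComponent k Q))
      (atTop ×ˢ 𝓝 p) (𝓝 (eval p (homogeneousComponent k Q))) :=
    (continuous_eval _).continuousAt.tendsto.comp tendsto_snd
  have hlower (k : ℕ) (hk : k ∈ Finset.range m) :
      Tendsto (fun q : ℝ × (σ → ℝ) => q.1 ^ k / q.1 ^ m * eval q.2 (homogeneousComponent k Q))
        (atTop ×ˢ 𝓝 p) (𝓝 0) := by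
    simpa using ((tendsto_pow_div_pow_atTop_zero (Finset.mem_range.1 hk)).comp
      tendsto_fst).mul (hcomp k)
  have hsum := (tendsto_finsetSum (Finset.range m) hlower).add (hcomp m)
  rw [Finset.sum_const_zero, zero_add] at hsum
  refine hsum.congr' ?_
  filter_upwards [tendsto_fst.eventually (eventually_gt_atTop 0)] with q hq
  conv_rhs => rw [← sum_homogeneousComponent Q]
  rw [map_sum, Finset.sum_div, Finset.sum_range_succ]
  simp_rw [eval_smul_of_isHomogeneous (homogeneousComponent_isHomogeneous _ Q), mul_div_right_comm]
  rw [div_self (pow_pos hq _).ne', one_mul]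

theorem even_totalDegree_of_forall_eval_le {b : ℝ} (hb : ∀ x, eval x Q ≤ b) :
    Even Q.totalDegree := by
  by_contra hodd
  rw [Nat.not_even_iff_odd] at hodd
  have hnonpos (p : σ → ℝ) : eval p (homogeneousComponent Q.totalDegree Q) ≤ 0 := by
    have hlim := (tendsto_eval_smul_div_pow Q p).comp
      (tendsto_id.prodMk (tendsto_const_nhds (x := p)))
    have hzero : Tendsto (fun R : ℝ => b / R ^ Q.totalDegree) atTop (𝓝 0) :=
      tendsto_const_nhds.div_atTop (tendsto_pow_atTop hodd.pos.ne')
    refine le_of_tendsto_of_tendsto hlim hzero ?_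
    filter_upwards [eventually_gt_atTop 0] with R hR
    exact div_le_div_of_nonneg_right (hb _) (by positivity)
  have hQ : Q ≠ 0 := by
    rintro rfl
    simp at hodd
  obtain ⟨p, hp⟩ := exists_eval_homogeneousComponent_totalDegree_ne_zero hQ
  have hneg :=
    eval_smul_of_isHomogeneous (homogeneousComponent_isHomogeneous Q.totalDegree Q) (-1) p
  rw [hodd.neg_one_pow] at hneg
  exact hp (le_antisymm (hnonpos p) (by linarith [hnonpos ((-1 : ℝ) • p)]))

theorem exists_forall_ne_eval_of_totalDegree_ne_zero (hQ : Q.totalDegree ≠ 0) (c : ℝ) :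
    ∃ x, eval x Q ≠ c := by
  by_contra! h
  have : Q = C c := MvPolynomial.funext fun x => by rw [eval_C, h]
  exact hQ (this ▸ totalDegree_C c)

variable {ι : Type*} [Fintype ι]

theorem contDiff_eval {n : WithTop ℕ∞} (Q : MvPolynomial ι ℝ) :
    ContDiff ℝ n fun x : EuclideanSpace ℝ ι => eval (fun i => x i) Q :=
  AnalyticOnNhd.contDiff <| AnalyticOnNhd.eval_continuousLinearMap' (𝕜 := ℝ)
    (fun i => (EuclideanSpace.proj i : EuclideanSpace ℝ ι →L[ℝ] ℝ)) Q

theorem exists_isCompact_growth {Q : MvPolynomial ι ℝ} (hQ : Q ≠ 0) :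
    ∃ K : Set (EuclideanSpace ℝ ι), IsCompact K ∧ volume K ≠ 0 ∧ ∃ κ : ℝ, 0 < κ ∧
      ∀ᶠ R : ℝ in atTop, ∀ x ∈ K, κ * R ^ Q.totalDegree ≤ |eval (fun i => (R • x) i) Q| := by
  obtain ⟨p, hp⟩ := exists_eval_homogeneousComponent_totalDegree_ne_zero hQ
  have hlim : Tendsto (fun q : ℝ × EuclideanSpace ℝ ι =>
      |eval (fun i => (q.1 • q.2) i) Q / q.1 ^ Q.totalDegree|) (atTop ×ˢ 𝓝 (WithLp.toLp 2 p))
      (𝓝 |eval p (homogeneousComponent Q.totalDegree Q)|) :=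
    ((tendsto_eval_smul_div_pow Q p).comp
      (tendsto_id.prodMap (PiLp.continuous_ofLp 2 _).continuousAt.tendsto)).abs
  obtain ⟨U, hU, V, hV, hUV⟩ := eventually_prod_iff.1
    (hlim.eventually_const_le (half_lt_self (abs_pos.2 hp)))
  obtain ⟨r, hr, hrV⟩ := nhds_basis_closedBall.eventually_iff.1 hV
  refine ⟨closedBall (WithLp.toLp 2 p) r, isCompact_closedBall _ _,
    (measure_closedBall_pos _ _ hr).ne', _, half_pos (abs_pos.2 hp), ?_⟩
  filter_upwards [hU, eventually_gt_atTop 0] with R hR hR0 x hx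
  have hquot := hUV hR (hrV hx)
  rwa [abs_div, abs_of_pos (pow_pos hR0 _), le_div_iff₀ (pow_pos hR0 _)] at hquot

end Polynomial

section Quadratic

variable {E : Type*} [NormedAddCommGroup E] [InnerProductSpace ℝ E]

variable (E) in
/-- The real functions on `E` which are polynomials of degree at most two, written in terms of
the inner product. -/
def quadraticFunctions : Submodule ℝ (E → ℝ) where
  carrier := {f | ∃ (c : ℝ) (b : E) (T : E →ₗ[ℝ] E), T.IsSymmetric ∧
    ∀ x, f x = c + ⟪b, x⟫ + ⟪T x, x⟫}
  zero_mem' := ⟨0, 0, 0, LinearMap.IsSymmetric.zero, by simp⟩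
  add_mem' := by
    rintro f g ⟨c, b, T, hT, hf⟩ ⟨c', b', T', hT', hg⟩
    refine ⟨c + c', b + b', T + T', hT.add hT', fun x => ?_⟩
    simp only [Pi.add_apply, hf, hg, inner_add_left, LinearMap.add_apply]
    ring
  smul_mem' := by
    rintro s f ⟨c, b, T, hT, hf⟩
    refine ⟨s * c, s • b, s • T, hT.smul (by simp), fun x => ?_⟩
    simp only [Pi.smul_apply, smul_eq_mul, hf, real_inner_smul_left, LinearMap.smul_apply]
    ring

theorem const_mem_quadraticFunctions (c : ℝ) : (fun _ => c) ∈ quadraticFunctions E :=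
  ⟨c, 0, 0, LinearMap.IsSymmetric.zero, by simp⟩

theorem inner_mem_quadraticFunctions (b : E) : (fun x => ⟪b, x⟫) ∈ quadraticFunctions E :=
  ⟨0, b, 0, LinearMap.IsSymmetric.zero, by simp⟩

theorem inner_mul_inner_mem_quadraticFunctions (y z : E) :
    (fun x => ⟪y, x⟫ * ⟪z, x⟫) ∈ quadraticFunctions E := by
  refine ⟨0, 0, (2⁻¹ : ℝ) • ((innerₛₗ ℝ y).smulRight z + (innerₛₗ ℝ z).smulRight y),
    fun x x' => ?_, fun x => ?_⟩
  · simp only [LinearMap.smul_apply, LinearMap.add_apply, LinearMap.smulRight_apply,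
      innerₛₗ_apply_apply, real_inner_smul_left, real_inner_smul_right, inner_add_left,
      inner_add_right, real_inner_comm x]
    ring
  · simp only [LinearMap.smul_apply, LinearMap.add_apply, LinearMap.smulRight_apply,
      innerₛₗ_apply_apply, real_inner_smul_left, inner_add_left, inner_zero_left]
    ring

section Eval

open MvPolynomial

variable {ι : Type*} [Fintype ι]

theorem exists_eval_eq_inner_of_isHomogeneous_one {P : MvPolynomial ι ℝ}
    (hP : P.IsHomogeneous 1) :
    ∃ b : EuclideanSpace ℝ ι, ∀ x : EuclideanSpace ℝ ι, eval (fun i => x i) P = ⟪b, x⟫ := by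
  rw [← mem_homogeneousSubmodule, homogeneousSubmodule_one_eq_span_X] at hP
  induction hP using Submodule.span_induction with
  | mem P hP =>
    obtain ⟨i, rfl⟩ := hP
    exact ⟨EuclideanSpace.basisFun ι ℝ i, fun x => by
      rw [eval_X, EuclideanSpace.basisFun_inner]⟩
  | zero => exact ⟨0, by simp⟩
  | add P P' _ _ h h' =>
    obtain ⟨b, hb⟩ := h
    obtain ⟨b', hb'⟩ := h'
    exact ⟨b + b', fun x => by rw [map_add, hb, hb', inner_add_left]⟩
  | smul c P _ h =>
    obtain ⟨b, hb⟩ := h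
    exact ⟨c • b, fun x => by rw [smul_eval, hb, real_inner_smul_left]⟩

theorem eval_mem_quadraticFunctions_of_isHomogeneous_two {P : MvPolynomial ι ℝ}
    (hP : P.IsHomogeneous 2) :
    (fun x : EuclideanSpace ℝ ι => eval (fun i => x i) P) ∈ quadraticFunctions _ := by
  rw [← mem_homogeneousSubmodule, ← homogeneousSubmodule_one_pow, pow_two] at hP
  induction hP using Submodule.mul_induction_on' with
  | mem_mul_mem P hP P' hP' =>
    obtain ⟨b, hb⟩ := exists_eval_eq_inner_of_isHomogeneous_one hP
    obtain ⟨b', hb'⟩ := exists_eval_eq_inner_of_isHomogeneous_one hP'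
    simp_rw [map_mul, hb, hb']
    exact inner_mul_inner_mem_quadraticFunctions b b'
  | add P _ P' _ h h' =>
    simp_rw [map_add]
    exact add_mem h h'

theorem eval_mem_quadraticFunctions {Q : MvPolynomial ι ℝ} (hQ : Q.totalDegree ≤ 2) :
    (fun x : EuclideanSpace ℝ ι => eval (fun i => x i) Q) ∈ quadraticFunctions _ := by
  have hcomp (k : ℕ) (hk : k ≤ 2) : (fun x : EuclideanSpace ℝ ι =>
      eval (fun i => x i) (homogeneousComponent k Q)) ∈ quadraticFunctions _ := by
    interval_cases k
    · simp_rw [homogeneousComponent_zero, eval_C]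
      exact const_mem_quadraticFunctions _
    · obtain ⟨b, hb⟩ :=
        exists_eval_eq_inner_of_isHomogeneous_one (homogeneousComponent_isHomogeneous 1 Q)
      simp_rw [hb]
      exact inner_mem_quadraticFunctions b
    · exact eval_mem_quadraticFunctions_of_isHomogeneous_two
        (homogeneousComponent_isHomogeneous 2 Q)
  rw [← sum_homogeneousComponent Q]
  simp_rw [map_sum]
  rw [← Finset.sum_fn]
  exact sum_mem fun k hk => hcomp k ((Finset.mem_range_succ_iff.1 hk).trans hQ)

end Eval

theorem quadratic_coeff_nonpos_of_forall_le {c k l B : ℝ}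
    (h : ∀ t : ℝ, c + k * t + l * t ^ 2 ≤ B) : l ≤ 0 := by
  have hlim : Tendsto (fun t : ℝ => (B - c) / t ^ 2 - k / t) atTop (𝓝 (0 - 0)) :=
    (tendsto_const_nhds.div_atTop (tendsto_pow_atTop two_ne_zero)).sub
      (tendsto_const_nhds.div_atTop tendsto_id)
  rw [sub_zero] at hlim
  refine ge_of_tendsto hlim ?_
  filter_upwards [eventually_gt_atTop 0] with t ht
  have := h t
  rw [div_sub_div _ _ (by positivity) ht.ne', le_div_iff₀ (by positivity)]
  nlinarith

theorem linear_coeff_eq_zero_of_forall_le {c k B : ℝ} (h : ∀ t : ℝ, c + k * t ≤ B) : k = 0 := by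
  by_contra hk
  have := h ((B - c + 1) / k)
  rw [mul_div_cancel₀ _ hk] at this
  linarith

variable [FiniteDimensional ℝ E]

/-- On each line `f` is a one-variable quadratic bounded above: this makes `T` negative
semidefinite and `b` orthogonal to `ker T`, so `b` lies in the range of `T`. -/
theorem exists_eq_add_inner_sub_of_mem_quadraticFunctions {f : E → ℝ}
    (hf : f ∈ quadraticFunctions E) {B : ℝ} (hB : ∀ x, f x ≤ B) :
    ∃ (x₀ : E) (T : E →ₗ[ℝ] E), (∀ x, ⟪T x, x⟫ ≤ 0) ∧
      ∀ x, f x = f x₀ + ⟪T (x - x₀), x - x₀⟫ := by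
  obtain ⟨c, b, T, hT, hf⟩ := hf
  have hline (y : E) (t : ℝ) : c + ⟪b, y⟫ * t + ⟪T y, y⟫ * t ^ 2 ≤ B := by
    have := hB (t • y)
    rw [hf, map_smul, real_inner_smul_right, real_inner_smul_right, real_inner_smul_left] at this
    linarith
  have hker : b ∈ (LinearMap.ker T)ᗮ := by
    rw [Submodule.mem_orthogonal']
    intro y hy
    refine linear_coeff_eq_zero_of_forall_le (c := c) (B := B) fun t => ?_
    simpa [LinearMap.mem_ker.1 hy] using hline y t
  rw [LinearMap.orthogonal_ker, hT.adjoint_eq] at hker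
  obtain ⟨w, hw⟩ := hker
  refine ⟨-((2⁻¹ : ℝ) • w), T, fun y => quadratic_coeff_nonpos_of_forall_le (hline y),
    fun x => ?_⟩
  have hcross : ⟪T x, w⟫ = ⟪b, x⟫ := by rw [hT x w, hw, real_inner_comm]
  simp only [hf, map_sub, map_neg, map_smul, hw, inner_sub_left, inner_sub_right, inner_neg_left,
    inner_neg_right, real_inner_smul_left, real_inner_smul_right, hcross]
  ring

theorem fderiv_add_inner_sub (T : E →ₗ[ℝ] E) (c : ℝ) (x₀ x : E) :
    fderiv ℝ (fun x => c + ⟪T (x - x₀), x - x₀⟫) x (x - x₀) = 2 * ⟪T (x - x₀), x - x₀⟫ := by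
  have hsub : HasFDerivAt (fun x : E => x - x₀) (ContinuousLinearMap.id ℝ E) x :=
    (hasFDerivAt_id x).sub_const x₀
  have hT : HasFDerivAt (fun x : E => T (x - x₀)) T.toContinuousLinearMap x :=
    T.toContinuousLinearMap.hasFDerivAt.comp x hsub
  rw [((hT.inner ℝ hsub).const_add c).fderiv]
  simp [fderivInnerCLM_apply, two_mul]

theorem exists_center_of_mem_quadraticFunctions {f : E → ℝ} (hf : f ∈ quadraticFunctions E)
    {B : ℝ} (hB : ∀ x, f x ≤ B) :
    ∃ x₀, (∀ x, f x ≤ f x₀) ∧ ∀ x, fderiv ℝ f x (x - x₀) = 2 * (f x - f x₀) := by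
  obtain ⟨x₀, T, hneg, hf⟩ := exists_eq_add_inner_sub_of_mem_quadraticFunctions hf hB
  refine ⟨x₀, fun x => by linarith [hf x, hneg (x - x₀)], fun x => ?_⟩
  have hderiv := fderiv_add_inner_sub T (f x₀) x₀ x
  rw [← funext hf] at hderiv
  rw [hderiv, hf x, add_sub_cancel_left]

end Quadratic

section MassBound

theorem integral_mul_lt_mul_integral {X : Type*} [TopologicalSpace X] [MeasurableSpace X]
    {μ : Measure X} [μ.IsOpenPosMeasure] {f w : X → ℝ} {b : ℝ} {x₁ : X} (hf : Continuous f)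
    (hw : Continuous w) (hw_int : Integrable w μ) (hfw_int : Integrable (fun x => f x * w x) μ)
    (hw_pos : ∀ x, 0 < w x) (hfb : ∀ x, f x ≤ b) (hx₁ : f x₁ ≠ b) :
    ∫ x, f x * w x ∂μ < b * ∫ x, w x ∂μ := by
  have hpos : 0 < ∫ x, (b * w x - f x * w x) ∂μ := by
    refine integral_pos_of_integrable_nonneg_nonzero (x := x₁) (by fun_prop)
      ((hw_int.const_mul b).sub hfw_int) (fun x => ?_) ?_
    · exact sub_nonneg.2 (mul_le_mul_of_nonneg_right (hfb x) (hw_pos x).le)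
    · rw [← sub_mul]
      exact mul_ne_zero (sub_ne_zero.2 hx₁.symm) (hw_pos x₁).ne'
  rw [integral_sub (hw_int.const_mul b) hfw_int, integral_const_mul] at hpos
  linarith

theorem lt_mul_integral_exp_of_le {X : Type*} [TopologicalSpace X] [MeasurableSpace X]
    {μ : Measure X} [μ.IsOpenPosMeasure] {v Q : X → ℝ} {a b : ℝ} (ha : 0 < a)
    (hv : Continuous v) (hQ : Continuous Q) (hw : Integrable (fun x => Real.exp (v x)) μ)
    (hρ : Integrable (fun x => Q x * Real.exp (v x)) μ) (hQb : ∀ x, Q x ≤ b)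
    (hne : ∃ x, Q x ≠ b) :
    a * (∫ x, Q x * Real.exp (v x) ∂μ) < a * (b * ∫ x, Real.exp (v x) ∂μ) := by
  obtain ⟨x₁, hx₁⟩ := hne
  gcongr
  exact integral_mul_lt_mul_integral hQ (by fun_prop) hw hρ (fun x => Real.exp_pos _) hQb hx₁

section Potential

variable {E : Type*} [NormedAddCommGroup E] [InnerProductSpace ℝ E] [FiniteDimensional ℝ E]
  [MeasurableSpace E] [BorelSpace E] {μ : Measure E} [μ.IsAddHaarMeasure] {v Q : E → ℝ}
  {a b q C : ℝ}

theorem mul_integral_exp_eq_of_const (hE : 1 < finrank ℝ E) (hv : ContDiff ℝ 1 v)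
    (hw : Integrable (fun x => Real.exp (v x)) μ)
    (hvρ : ∀ x, v x = a * logPotential μ (fun x => q * Real.exp (v x)) x + C) :
    a * (q * ∫ x, Real.exp (v x) ∂μ) = 2 * finrank ℝ E := by
  have : Nontrivial E := nontrivial_of_finrank_pos (R := ℝ) (by omega)
  have hq : q ≠ 0 := by
    rintro rfl
    have hvC : v = fun _ => C := by
      funext x
      simp [hvρ x, logPotential]
    simp [hvC, integrable_const_iff, isFiniteMeasure_iff, (Real.exp_pos _).ne'] at hw
  have hV : 0 < ∫ x, Real.exp (v x) ∂μ := integral_exp_pos hw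
  have hpoh := pohozaev_identity (Q := fun _ => q) hE 0 hv contDiff_const (hw.const_mul q) hvρ
    (by simp)
  simp only [fderiv_const_apply, zero_apply, zero_mul, integral_zero, add_zero,
    integral_const_mul] at hpoh
  refine mul_right_cancel₀ (mul_ne_zero hq hV.ne') ?_
  linarith

theorem lt_mul_integral_exp_of_quadratic (hE : 1 < finrank ℝ E) (ha : 0 < a)
    (hv : ContDiff ℝ 1 v) (hQ : ContDiff ℝ 1 Q) (hw : Integrable (fun x => Real.exp (v x)) μ)
    (hρ : Integrable (fun x => Q x * Real.exp (v x)) μ)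
    (hvρ : ∀ x, v x = a * logPotential μ (fun x => Q x * Real.exp (v x)) x + C)
    (hquad : Q ∈ quadraticFunctions E) (hQb : ∀ x, Q x ≤ b) (hne : ∀ c, ∃ x, Q x ≠ c)
    (hα : 4 < a * ∫ x, Q x * Real.exp (v x) ∂μ) :
    2 * finrank ℝ E < a * (b * ∫ x, Real.exp (v x) ∂μ) := by
  obtain ⟨x₀, hmax, hfderiv⟩ := exists_center_of_mem_quadraticFunctions hquad hQb
  have hV : 0 < ∫ x, Real.exp (v x) ∂μ := integral_exp_pos hw
  have hstrict := lt_mul_integral_exp_of_le ha hv.continuous hQ.continuous hw hρ hmax (hne (Q x₀))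
  have hW (x : E) : fderiv ℝ Q x (x - x₀) * Real.exp (v x) =
      2 * (Q x * Real.exp (v x) - Q x₀ * Real.exp (v x)) := by rw [hfderiv]; ring
  have hpoh := pohozaev_identity hE x₀ hv hQ hρ hvρ (by
    simp_rw [hW]
    exact (hρ.sub (hw.const_mul _)).const_mul 2)
  simp_rw [hW] at hpoh
  rw [integral_const_mul, integral_sub hρ (hw.const_mul _), integral_const_mul] at hpoh
  set V := ∫ x, Real.exp (v x) ∂μ
  set α := a * ∫ x, Q x * Real.exp (v x) ∂μ with hα_def
  have hmass : 4 * (a * (Q x₀ * V)) = 2 * (finrank ℝ E + 2) * α - α ^ 2 := by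
    rw [hα_def]
    linear_combination -2 * a * hpoh
  have hα_lt : α < 2 * finrank ℝ E := by nlinarith
  calc 2 * (finrank ℝ E : ℝ) < a * (Q x₀ * V) := by
        nlinarith [mul_pos (sub_pos.2 hα) (sub_pos.2 hα_lt)]
    _ ≤ a * (b * V) := by gcongr; exact hQb x₀

end Potential

open MvPolynomial in
theorem lt_mul_integral_exp_of_polynomial {ι : Type*} [Fintype ι] (hι : 2 ≤ Fintype.card ι)
    (hι' : Fintype.card ι ≤ 4) {Q : MvPolynomial ι ℝ} {v : EuclideanSpace ℝ ι → ℝ} {a b C : ℝ}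
    (ha : 0 < a) (hv : ContDiff ℝ 1 v) (hw : Integrable fun x => Real.exp (v x))
    (hρ : Integrable fun x : EuclideanSpace ℝ ι => eval (fun i => x i) Q * Real.exp (v x))
    (hvρ : ∀ x, v x =
      a * logPotential volume (fun x => eval (fun i => x i) Q * Real.exp (v x)) x + C)
    (hQb : ∀ x : EuclideanSpace ℝ ι, eval (fun i => x i) Q ≤ b)
    (hne : ∃ x : EuclideanSpace ℝ ι, eval (fun i => x i) Q ≠ b) :
    2 * Fintype.card ι < a * (b * ∫ x, Real.exp (v x)) := by
  have hdim : finrank ℝ (EuclideanSpace ℝ ι) = Fintype.card ι := finrank_euclideanSpace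
  have hE : 1 < finrank ℝ (EuclideanSpace ℝ ι) := by omega
  have hstrict := lt_mul_integral_exp_of_le ha hv.continuous (contDiff_eval (n := 1) Q).continuous
    hw hρ hQb hne
  rcases eq_or_ne Q.totalDegree 0 with hdeg | hdeg
  · rw [totalDegree_eq_zero_iff_eq_C] at hdeg
    rw [hdeg] at hvρ hstrict
    simp only [eval_C, integral_const_mul] at hvρ hstrict
    rwa [mul_integral_exp_eq_of_const hE hv hw hvρ, hdim] at hstrict
  have hQ0 : Q ≠ 0 := by
    rintro rfl
    exact hdeg totalDegree_zero
  obtain ⟨K, hK, hK0, κ, hκ, hgrowth⟩ := exists_isCompact_growth hQ0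
  have hα := finrank_add_le_of_growth hE hK hK0 hv.continuous
    (contDiff_eval (n := 1) Q).continuous hρ hvρ hκ hgrowth
  rw [hdim] at hα
  rcases le_or_gt (Fintype.card ι) Q.totalDegree with hle | hlt
  · have : (Fintype.card ι : ℝ) ≤ Q.totalDegree := by exact_mod_cast hle
    linarith
  · obtain ⟨k, hk⟩ := even_totalDegree_of_forall_eval_le fun x => hQb (WithLp.toLp 2 x)
    have h4 : 4 < (Fintype.card ι : ℝ) + Q.totalDegree := by exact_mod_cast (by omega)
    rw [← hdim]
    refine lt_mul_integral_exp_of_quadratic hE ha hv (contDiff_eval Q) hw hρ hvρ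
      (eval_mem_quadraticFunctions (by omega)) hQb (fun c => ?_) (h4.trans_le hα)
    obtain ⟨x, hx⟩ := exists_forall_ne_eval_of_totalDegree_ne_zero hdeg c
    exact ⟨WithLp.toLp 2 x, hx⟩

end MassBound

open MvPolynomial in
theorem theorem1p2_general {ι : Type*} [Fintype ι] (hι : 2 ≤ Fintype.card ι)
    (hι' : Fintype.card ι ≤ 4) {Q : MvPolynomial ι ℝ} {v : EuclideanSpace ℝ ι → ℝ} {a b C : ℝ}
    (ha : 0 < a) (hb : 0 < b) (hv : ContDiff ℝ 1 v)
    (hρ : Integrable fun x : EuclideanSpace ℝ ι => eval (fun i => x i) Q * Real.exp (v x))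
    (hvρ : ∀ x, v x =
      a * logPotential volume (fun x => eval (fun i => x i) Q * Real.exp (v x)) x + C)
    (hQb : ∀ x : EuclideanSpace ℝ ι, eval (fun i => x i) Q ≤ b) :
    ENNReal.ofReal (2 * Fintype.card ι / (a * b)) ≤ ∫⁻ x, ENNReal.ofReal (Real.exp (v x)) ∧
      (∫⁻ x, ENNReal.ofReal (Real.exp (v x)) = ENNReal.ofReal (2 * Fintype.card ι / (a * b)) ↔
        ∀ x : EuclideanSpace ℝ ι, eval (fun i => x i) Q = b) := by
  have hnonneg : 0 ≤ᵐ[volume] fun x => Real.exp (v x) := .of_forall fun x => (Real.exp_pos _).le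
  by_cases h : ∀ x : EuclideanSpace ℝ ι, eval (fun i => x i) Q = b
  · simp only [h] at hρ hvρ
    have hw := (integrable_const_mul_iff hb.ne'.isUnit _).1 hρ
    have hmass := mul_integral_exp_eq_of_const (by rwa [finrank_euclideanSpace]) hv hw hvρ
    have heq : ∫ x, Real.exp (v x) = 2 * Fintype.card ι / (a * b) := by
      rw [eq_div_iff (by positivity), ← finrank_euclideanSpace (𝕜 := ℝ), ← hmass]
      ring
    rw [← ofReal_integral_eq_lintegral_ofReal hw hnonneg, heq]
    exact ⟨le_rfl, iff_of_true rfl h⟩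
  · suffices hlt : ENNReal.ofReal (2 * Fintype.card ι / (a * b)) <
        ∫⁻ x, ENNReal.ofReal (Real.exp (v x)) from ⟨hlt.le, iff_of_false hlt.ne' h⟩
    by_cases hw : Integrable fun x => Real.exp (v x)
    · rw [← ofReal_integral_eq_lintegral_ofReal hw hnonneg,
        ENNReal.ofReal_lt_ofReal_iff (integral_exp_pos hw), div_lt_iff₀ (by positivity)]
      linarith [lt_mul_integral_exp_of_polynomial hι hι' ha hv hw hρ hvρ hQb (not_forall.1 h)]
    · rw [not_ne_iff.1 (mt (lintegral_ofReal_ne_top_iff_integrable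
        hv.continuous.rexp.aestronglyMeasurable hnonneg).1 hw)]
      exact ENNReal.ofReal_lt_top

theorem volS4_ne_top : volS4 ≠ ⊤ := measure_ne_top _ _

theorem volS4_toReal_pos : 0 < volS4.toReal := by
  refine ENNReal.toReal_pos ?_ volS4_ne_top
  rw [volS4, Ne, Measure.measure_univ_eq_zero]
  exact Measure.toSphere_ne_zero _

theorem ofReal_two_mul_card_div_eq_volS4 :
    ENNReal.ofReal (2 * Fintype.card (Fin 4) / (8 / (6 * volS4.toReal) * 6)) = volS4 := by
  have hmass : 2 * ((4 : ℕ) : ℝ) / (8 / (6 * volS4.toReal) * 6) = volS4.toReal := by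
    field_simp
    norm_num
  rw [Fintype.card_fin, hmass, ENNReal.ofReal_toReal volS4_ne_top]

theorem IsNormalSolution.exists_eq_logPotential {Q u : E4 → ℝ} (hu : IsNormalSolution Q u) :
    ∃ C, ∀ x, 4 * u x = 8 / (6 * volS4.toReal) *
      logPotential volume (fun y => Q y * Real.exp (4 * u y)) x + C := by
  obtain ⟨C, hC⟩ := hu.integral_equation
  refine ⟨4 * C, fun x => ?_⟩
  rw [hC, logPotential]
  ring

theorem theorem1p2 (Q : MvPolynomial (Fin 4) ℝ) (u : E4 → ℝ)
    (hu : IsNormalSolution (fun x => MvPolynomial.eval (fun i => x i) Q) u)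
    (hQ : ∀ x : E4, MvPolynomial.eval (fun i => x i) Q ≤ 6) :
    volS4 ≤ ∫⁻ x : E4, ENNReal.ofReal (Real.exp (4 * u x)) ∧
      ((∫⁻ x : E4, ENNReal.ofReal (Real.exp (4 * u x))) = volS4 ↔
        ∀ x : E4, MvPolynomial.eval (fun i => x i) Q = 6) := by
  obtain ⟨C, hC⟩ := hu.exists_eq_logPotential
  have ha : 0 < 8 / (6 * volS4.toReal) := by have := volS4_toReal_pos; positivity
  have hv : ContDiff ℝ 1 fun x => 4 * u x :=
    contDiff_const.mul (hu.smooth.of_le (by exact_mod_cast le_top))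
  rw [← ofReal_two_mul_card_div_eq_volS4]
  exact theorem1p2_general (by simp) (by simp) ha (by norm_num) hv hu.integrable hC hQ
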